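/- Let $D<-3$ be a squarefree integer, $K=\mathbb{Q}(\sqrt{D})\subset\mathbb{C}$ with ring of integers $\mathcal{O}$, and let $\Lambda=\mathcal{O}^{n+1}$ carry a $K$-valued hermitian form $h(x,y)=y^{*}Q'x$ of signature $(n,1)$. Let $\mathbb{C}H^n=\{[\omega]\in\mathbb{P}(\Lambda\otimes_{\mathcal O}\mathbb{C}) : h(\omega,\omega)<0\}$, let $U(\Lambda)$ be the group of automorphisms of $\Lambda$ preserving $h$, and let $\Gamma\le U(\Lambda)$ be a subgroup of finite index with $-1\in\Gamma$ (this does not restrict the quotients $\Gamma\backslash\mathbb{C}H^n$, since $-1$ acts trivially). Let $F$ be a $0$-dimensional cusp, i.e. an isotropic line $E$ defined over $K$. Let $N(F)$ be the stabiliser of $E_{\mathbb C}$ in $U(h)\cong U(n,1)$, $W(F)$ the subgroup of unipotent elements of $N(F)$, $U(F)$ the centre of $W(F)$, and put $N(F)_{\mathbb Z}=N(F)\cap\Gamma$, $U(F)_{\mathbb Z}=U(F)\cap\Gamma$. Choose a $K$-basis $b_1,\dots,b_{n+1}$ of $\Lambda\otimes_{\mathcal O} K$ such that $b_1$ spans $E$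 and the Gram matrix $(b_i^{*}Q'b_j)_{i,j}$ has the block form $\begin{pmatrix}0&0&a\\0&B&0\\ \bar a&0&0\end{pmatrix}$ with blocks of sizes $1,n-1,1$. A point of $\mathbb{C}H^n$ with homogeneous coordinates $(t_1:\dots:t_{n+1})$ in this basis has affine coordinates $\alpha=t_1/t_{n+1}$ and $\underline{w}=(t_2,\dots,t_n)/t_{n+1}$. The group $U(F)_{\mathbb Z}$ acts by $\alpha\mapsto\alpha+\sigma k$, $k\in\mathbb{Z}$, where $\sigma=iax_0$ with $x_0>0$ least possible. With $\theta=e^{2\pi i\alpha/\sigma}$, the coordinates $(\theta,\underline{w})$ identify $\mathbb{C}H^n(F)=\mathbb{C}H^n/U(F)_{\mathbb Z}$ with an open subset of $\mathbb{C}^{*}\times\mathbb{C}^{n-1}$. The partial compactification over $F$ is obtained by adding the boundary divisor $\{\theta=0\}=\{0\}\times\mathbb{C}^{n-1}$, with the topology induced from $\mathbb{C}\times\mathbb{C}^{n-1}$. Then the action of every element of $N(F)_{\mathbb Z}/U(F)_{\mathbb Z}$ on $\mathbb{C}H^n(F)$ extends uniquely to a continuous self-map of the partial compactification, and no element of $N(F)_{\mathbb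 Z}/U(F)_{\mathbb Z}$ other than the classes of $1$ and of $-1$ (the latter acts trivially) fixes the boundary divisor $\{\theta=0\}$ pointwise. -/

import Mathlib

open scoped Matrix LinearAlgebra.Projectivization MatrixGroups

namespace BallQuotient

/-- The imaginary quadratic number field `ℚ(√D)`, `D < 0`, as a subfield of `ℂ`. -/
noncomputable def quadField (D : ℤ) : IntermediateField ℚ ℂ :=
  IntermediateField.adjoin ℚ {Complex.I * (Real.sqrt (-(D : ℝ)) : ℂ)}

/-- A hermitian lattice of signature `(n,1)` over the ring of integers `𝒪` of `ℚ(√D)`: the free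
module `Λ = 𝒪^(n+1)` with the hermitian form `h(x,y) = yᴴ Q x`, where the hermitian matrix `Q` has
entries in `ℚ(√D)` and is congruent over `ℂ` to `diag(1,…,1,-1)`. -/
structure HermitianLattice (D : ℤ) (n : ℕ) where
  Q : Matrix (Fin (n + 1)) (Fin (n + 1)) ℂ
  entry_mem : ∀ i j, Q i j ∈ quadField D
  isHermitian : Q.IsHermitian
  signature : ∃ P : Matrix (Fin (n + 1)) (Fin (n + 1)) ℂ, IsUnit P.det ∧
    Pᴴ * Q * P = Matrix.diagonal (fun i => if i = Fin.last n then (-1 : ℂ) else 1)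

namespace HermitianLattice

variable {D : ℤ} {n : ℕ} (L : HermitianLattice D n)

/-- The hermitian form on `Λ ⊗ ℂ = ℂ^(n+1)`, linear in `x` and antilinear in `y`. -/
def h (x y : Fin (n + 1) → ℂ) : ℂ := star y ⬝ᵥ (L.Q *ᵥ x)

/-- The real group `Γ_ℝ = U(n,1)` of all complex matrices that preserve the form. -/
def realUnitary : Subgroup (GL (Fin (n + 1)) ℂ) where
  carrier := {g | (g : Matrix (Fin (n + 1)) (Fin (n + 1)) ℂ)ᴴ * L.Q * g.val = L.Q}
  one_mem' := by simp
  mul_mem' := by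
    intro a b ha hb
    simp only [Set.mem_ofPred_eq] at ha hb ⊢
    have e : ((a * b : GL (Fin (n + 1)) ℂ) : Matrix (Fin (n + 1)) (Fin (n + 1)) ℂ)
        = a.val * b.val := rfl
    rw [e, Matrix.conjTranspose_mul]
    calc b.valᴴ * a.valᴴ * L.Q * (a.val * b.val)
        = b.valᴴ * (a.valᴴ * L.Q * a.val) * b.val := by simp only [Matrix.mul_assoc]
      _ = L.Q := by rw [ha, hb]
  inv_mem' := by
    intro a ha
    simp only [Set.mem_ofPred_eq] at ha ⊢
    have e : a.val * (a⁻¹).val = 1 := a.mul_inv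
    have e' : ((a⁻¹).val)ᴴ * a.valᴴ = 1 := by
      rw [← Matrix.conjTranspose_mul, e, Matrix.conjTranspose_one]
    calc ((a⁻¹).val)ᴴ * L.Q * (a⁻¹).val
        = ((a⁻¹).val)ᴴ * (a.valᴴ * L.Q * a.val) * (a⁻¹).val := by rw [ha]
      _ = (((a⁻¹).val)ᴴ * a.valᴴ) * L.Q * (a.val * (a⁻¹).val) := by
          simp only [Matrix.mul_assoc]
      _ = L.Q := by rw [e, e', Matrix.one_mul, Matrix.mul_one]

/-- `U(Λ)`: the automorphisms of the `𝒪`-module `Λ = 𝒪^(n+1)` that preserve the form. -/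
noncomputable def latticeUnitary : Subgroup (GL (Fin (n + 1)) ℂ) :=
  (Matrix.GeneralLinearGroup.map (n := Fin (n + 1))
    (algebraMap (NumberField.RingOfIntegers (quadField D)) ℂ)).range ⊓ L.realUnitary

/-- Complex hyperbolic space `ℂHⁿ`: the negative lines in `ℙ(Λ ⊗ ℂ)`. -/
def hyperbolicSpace : Set (ℙ ℂ (Fin (n + 1) → ℂ)) :=
  {x | (L.h x.rep x.rep).re < 0}

/-- A `0`-dimensional cusp, given by an isotropic line `E` that is defined over `ℚ(√D)`. -/
def IsCusp (E : Submodule ℂ (Fin (n + 1) → ℂ)) : Prop :=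
  ∃ e : Fin (n + 1) → ℂ, e ≠ 0 ∧ (∀ i, e i ∈ quadField D) ∧ L.h e e = 0 ∧
    E = Submodule.span ℂ {e}

/-- `N(F) ⊂ Γ_ℝ`: the stabiliser of the cusp. -/
def N (E : Submodule ℂ (Fin (n + 1) → ℂ)) : Subgroup (GL (Fin (n + 1)) ℂ) where
  carrier := {g | g ∈ L.realUnitary ∧ E.map (Matrix.mulVecLin g.val) = E}
  one_mem' := ⟨one_mem _, by simp⟩
  mul_mem' := by
    rintro a b ⟨ha, ha'⟩ ⟨hb, hb'⟩
    refine ⟨mul_mem ha hb, ?_⟩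
    have e : ((a * b : GL (Fin (n + 1)) ℂ) : Matrix (Fin (n + 1)) (Fin (n + 1)) ℂ)
        = a.val * b.val := rfl
    rw [e, Matrix.mulVecLin_mul, Submodule.map_comp, hb', ha']
  inv_mem' := by
    rintro a ⟨ha, ha'⟩
    refine ⟨inv_mem ha, ?_⟩
    have e : (a⁻¹).val * a.val = 1 := a.inv_mul
    calc E.map (Matrix.mulVecLin (a⁻¹).val)
        = (E.map (Matrix.mulVecLin a.val)).map (Matrix.mulVecLin (a⁻¹).val) := by rw [ha']
      _ = E := by
          rw [← Submodule.map_comp, ← Matrix.mulVecLin_mul, e, Matrix.mulVecLin_one,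
            Submodule.map_id]

/-- `W(F)`: the subgroup of `N(F)` of all unipotent elements (they are closed under products, so
taking the generated subgroup adds nothing). -/
def W (E : Submodule ℂ (Fin (n + 1) → ℂ)) : Subgroup (GL (Fin (n + 1)) ℂ) :=
  Subgroup.closure {g | g ∈ L.N E ∧ IsNilpotent (g.val - 1)}

/-- `U(F)`: the centre of `W(F)`. -/
def U (E : Submodule ℂ (Fin (n + 1) → ℂ)) : Subgroup (GL (Fin (n + 1)) ℂ) :=
  L.W E ⊓ Subgroup.centralizer (L.W E : Set (GL (Fin (n + 1)) ℂ))

/-- `N(F)_ℤ = N(F) ∩ Γ`. -/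
def NZ (Γ : Subgroup (GL (Fin (n + 1)) ℂ)) (E : Submodule ℂ (Fin (n + 1) → ℂ)) :
    Subgroup (GL (Fin (n + 1)) ℂ) := L.N E ⊓ Γ

/-- `U(F)_ℤ = U(F) ∩ Γ`. -/
def UZ (Γ : Subgroup (GL (Fin (n + 1)) ℂ)) (E : Submodule ℂ (Fin (n + 1) → ℂ)) :
    Subgroup (GL (Fin (n + 1)) ℂ) := L.U E ⊓ Γ

lemma conj_mem_W {E : Submodule ℂ (Fin (n + 1) → ℂ)} {g x : GL (Fin (n + 1)) ℂ}
    (hg : g ∈ L.N E) (hx : x ∈ L.W E) : g * x * g⁻¹ ∈ L.W E := by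
  have key : L.W E ≤ (L.W E).comap (MulAut.conj g).toMonoidHom := by
    unfold W
    rw [Subgroup.closure_le]
    rintro y ⟨hy, k, hk⟩
    refine Subgroup.subset_closure ⟨mul_mem (mul_mem hg hy) (inv_mem hg), k, ?_⟩
    have e : g.val * (g⁻¹).val = 1 := g.mul_inv
    have e2 : ((MulAut.conj g).toMonoidHom y).val - 1 = g.val * (y.val - 1) * (g⁻¹).val := by
      have e3 : ((MulAut.conj g).toMonoidHom y).val = g.val * y.val * (g⁻¹).val := rfl
      rw [e3, mul_sub, sub_mul, mul_one, e]
    rw [e2, Units.conj_pow, hk]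
    simp
  exact key hx

instance normal_UZ (Γ : Subgroup (GL (Fin (n + 1)) ℂ)) (E : Submodule ℂ (Fin (n + 1) → ℂ)) :
    ((L.UZ Γ E).subgroupOf (L.NZ Γ E)).Normal where
  conj_mem := by
    rintro ⟨x, hx⟩ hxU ⟨g, hg⟩
    rw [Subgroup.mem_subgroupOf] at hxU ⊢
    obtain ⟨⟨hxW, hxC⟩, hxΓ⟩ := hxU
    have hgΓ : g ∈ Γ := hg.2
    have hxC' : x ∈ Subgroup.centralizer (L.W E : Set (GL (Fin (n + 1)) ℂ)) := hxC
    have hc : g * x * g⁻¹ ∈ Γ := Γ.mul_mem (Γ.mul_mem hgΓ hxΓ) (Γ.inv_mem hgΓ)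
    refine ⟨⟨L.conj_mem_W hg.1 hxW, ?_⟩, hc⟩
    change g * x * g⁻¹ ∈ Subgroup.centralizer (L.W E : Set (GL (Fin (n + 1)) ℂ))
    rw [Subgroup.mem_centralizer_iff] at hxC' ⊢
    intro y hy
    have h1 : g⁻¹ * y * g ∈ L.W E := by
      simpa using L.conj_mem_W (inv_mem hg.1) hy
    have h2 := hxC' _ h1
    change g⁻¹ * y * g * x = x * (g⁻¹ * y * g) at h2
    calc y * (g * x * g⁻¹) = g * (g⁻¹ * y * g * x) * g⁻¹ := by group
      _ = g * x * g⁻¹ * y := by rw [h2]; group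

/-- The group `N(F)_ℤ / U(F)_ℤ`. -/
abbrev CuspGroup (Γ : Subgroup (GL (Fin (n + 1)) ℂ)) (E : Submodule ℂ (Fin (n + 1) → ℂ)) : Type :=
  L.NZ Γ E ⧸ (L.UZ Γ E).subgroupOf (L.NZ Γ E)

lemma neg_one_mem_NZ {Γ : Subgroup (GL (Fin (n + 1)) ℂ)} (hΓ : -1 ∈ Γ)
    (E : Submodule ℂ (Fin (n + 1) → ℂ)) : (-1 : GL (Fin (n + 1)) ℂ) ∈ L.NZ Γ E := by
  refine ⟨⟨?_, ?_⟩, hΓ⟩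
  · change (-1 : Matrix (Fin (n + 1)) (Fin (n + 1)) ℂ)ᴴ * L.Q * (-1) = L.Q
    simp
  · change E.map (Matrix.mulVecLin (-1 : Matrix (Fin (n + 1)) (Fin (n + 1)) ℂ)) = E
    have e : Matrix.mulVecLin (-1 : Matrix (Fin (n + 1)) (Fin (n + 1)) ℂ) = -LinearMap.id := by
      ext1 i
      simp
    rw [e, Submodule.map_neg, Submodule.map_id]

/-- A basis `b₁, …, b_{n+1}` adapted to the cusp: `b₁` is `inl ()`, `b₂, …, b_n` are
`inr (inl i)` and `b_{n+1}` is `inr (inr ())`. The basis is defined over `ℚ(√D)`, `b₁` spans `E`,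
and the Gram matrix has the block form `(0 0 a; 0 B 0; ā 0 0)`. -/
structure AdaptedBasis (E : Submodule ℂ (Fin (n + 1) → ℂ)) where
  basis : Module.Basis (Unit ⊕ Fin (n - 1) ⊕ Unit) ℂ (Fin (n + 1) → ℂ)
  rational : ∀ i j, basis i j ∈ quadField D
  span_first : Submodule.span ℂ {basis (.inl ())} = E
  first_first : L.h (basis (.inl ())) (basis (.inl ())) = 0
  first_mid : ∀ i, L.h (basis (.inl ())) (basis (.inr (.inl i))) = 0
  mid_last : ∀ i, L.h (basis (.inr (.inl i))) (basis (.inr (.inr ()))) = 0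
  last_last : L.h (basis (.inr (.inr ()))) (basis (.inr (.inr ()))) = 0

namespace AdaptedBasis

variable {L} {E : Submodule ℂ (Fin (n + 1) → ℂ)} (b : L.AdaptedBasis E)

/-- The upper right entry `a = b₁ᴴ Q b_{n+1}` of the Gram matrix. -/
noncomputable def a : ℂ := L.h (b.basis (.inr (.inr ()))) (b.basis (.inl ()))

/-- The elements of `U(F)` act by `b_{n+1} ↦ b_{n+1} + i a x b₁` with `x` real. This is the least
`x > 0` that occurs in `U(F)_ℤ ≅ ℤ`. -/
noncomputable def period (Γ : Subgroup (GL (Fin (n + 1)) ℂ)) : ℝ :=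
  sInf {x : ℝ | 0 < x ∧ ∃ g ∈ L.UZ Γ E,
    g.val *ᵥ b.basis (.inr (.inr ())) =
      b.basis (.inr (.inr ())) + (Complex.I * b.a * x) • b.basis (.inl ())}

/-- The translation length `σ = i a x`: the generator of `U(F)_ℤ` acts by `α ↦ α + σ`. -/
noncomputable def sigma (Γ : Subgroup (GL (Fin (n + 1)) ℂ)) : ℂ :=
  Complex.I * b.a * b.period Γ

/-- The coordinate `α = t₁ / t_{n+1}`. -/
noncomputable def alpha (x : ℙ ℂ (Fin (n + 1) → ℂ)) : ℂ :=
  b.basis.repr x.rep (.inl ()) / b.basis.repr x.rep (.inr (.inr ()))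

/-- The coordinates `w = (t₂, …, t_n) / t_{n+1}`. -/
noncomputable def w (x : ℙ ℂ (Fin (n + 1) → ℂ)) : Fin (n - 1) → ℂ := fun i =>
  b.basis.repr x.rep (.inr (.inl i)) / b.basis.repr x.rep (.inr (.inr ()))

/-- The map `x ↦ (θ, w)` with `θ = exp(2πi α / σ)`. On `ℂHⁿ` it is the quotient map onto the
partial quotient `ℂHⁿ(F) = ℂHⁿ / U(F)_ℤ`, seen as an open subset of `ℂ* × ℂ^(n-1)`. -/
noncomputable def toTorus (Γ : Subgroup (GL (Fin (n + 1)) ℂ)) (x : ℙ ℂ (Fin (n + 1) → ℂ)) :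
    ℂ × (Fin (n - 1) → ℂ) :=
  (Complex.exp (2 * Real.pi * Complex.I * b.alpha x / b.sigma Γ), b.w x)

/-- The boundary divisor `θ = 0`, i.e. `{0} × ℂ^(n-1)`. -/
def boundaryDivisor (n : ℕ) : Set (ℂ × (Fin (n - 1) → ℂ)) := {p | p.1 = 0}

/-- The partial (toroidal) compactification of `ℂHⁿ(F)` over the cusp: `ℂHⁿ(F)` with
`{0} × ℂ^(n-1)` added, with the topology of `ℂ × ℂ^(n-1)`. -/
def partialCompactification (Γ : Subgroup (GL (Fin (n + 1)) ℂ)) :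
    Set (ℂ × (Fin (n - 1) → ℂ)) :=
  b.toTorus Γ '' L.hyperbolicSpace ∪ boundaryDivisor n

/-- `φ` is the continuous extension to the partial compactification of the action of
`γ ∈ N(F)_ℤ / U(F)_ℤ` on `ℂHⁿ(F) = ℂHⁿ / U(F)_ℤ`. -/
def IsExtendedAction (Γ : Subgroup (GL (Fin (n + 1)) ℂ)) (γ : L.CuspGroup Γ E)
    (φ : b.partialCompactification Γ → b.partialCompactification Γ) : Prop :=
  Continuous φ ∧ ∀ g : L.NZ Γ E, QuotientGroup.mk g = γ →
    ∀ (x : ℙ ℂ (Fin (n + 1) → ℂ)) (hx : x ∈ L.hyperbolicSpace),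
      (φ ⟨b.toTorus Γ x, Or.inl ⟨x, hx, rfl⟩⟩ : ℂ × (Fin (n - 1) → ℂ)) =
        b.toTorus Γ (Matrix.GeneralLinearGroup.toLin g.val • x)

end AdaptedBasis

end HermitianLattice

end BallQuotient

/-! An integral g that stabilises the cusp acts on the rational isotropic vector b₁ by a unit of 𝒪.
For squarefree D < -3 the units are ±1, so g b₁ = ε b₁ with ε = ±1 (`mulVec_eq_or_eq_neg`). Pairing
with b₁ reads off t_{n+1}, so g multiplies t_{n+1} by ε. In affine coordinates w then moves by an
affine map and α is shifted by an affine function of w alone. Hence θ is multiplied by a nowhere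
vanishing function of w (`toTorus_smul`), and the same formula at θ = 0 gives the extension. It is
unique because ℂHⁿ(F) is dense in the partial compactification (`boundary_mem_closure`).

If the extension fixes θ = 0 pointwise, then w is fixed. After replacing g by -g when ε = -1, one
has g b₁ = b₁, and invariance of h forces the shift of α to be constant. So g is a transvection
along b₁, and these are central in W(F) (`mem_UZ_of_repr_mid_eq`, `mem_U_of_transvection`). The
class of the original g is therefore that of 1 or of -1.

That the action descends to N(F)_ℤ / U(F)_ℤ needs θ to be invariant under U(F)_ℤ. This rests on the
converse, that the centre contains only transvections (`exists_transvection_of_mem_U`), and on their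
lengths in Γ forming a nonzero discrete subgroup of ℝ (`isLeast_period`). -/

namespace BallQuotient

/-! ### Integers and units of the imaginary quadratic field. -/

section Arithmetic

variable {D : ℤ}

lemma exists_rat_of_mem_quadField (hD : D < 0) {z : ℂ} (hz : z ∈ quadField D) :
    ∃ p q : ℚ, z = p + q * (Complex.I * (Real.sqrt (-(D : ℝ)) : ℂ)) := by
  have hd : (0 : ℝ) < -(D : ℝ) := by
    have : (D : ℝ) < 0 := by exact_mod_cast hD
    linarith
  have hs : (Complex.I * (Real.sqrt (-(D : ℝ)) : ℂ)) * (Complex.I * (Real.sqrt (-(D : ℝ)) : ℂ))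
      = (D : ℂ) := by
    have : ((Real.sqrt (-(D : ℝ)) : ℝ) : ℂ) * ((Real.sqrt (-(D : ℝ)) : ℝ) : ℂ) = -(D : ℂ) := by
      rw [← Complex.ofReal_mul, Real.mul_self_sqrt hd.le]; push_cast; ring
    linear_combination (Complex.I * Complex.I) * this - (D : ℂ) * Complex.I_mul_I
  set δ := Complex.I * (Real.sqrt (-(D : ℝ)) : ℂ) with hδ
  induction hz using IntermediateField.adjoin_induction with
  | mem x hx => exact ⟨0, 1, by rw [Set.mem_singleton_iff.1 hx]; simp [hδ]⟩
  | algebraMap x => exact ⟨x, 0, by simp⟩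
  | add x y hx hy h1 h2 =>
    obtain ⟨p, q, rfl⟩ := h1
    obtain ⟨p', q', rfl⟩ := h2
    exact ⟨p + p', q + q', by push_cast; ring⟩
  | mul x y hx hy h1 h2 =>
    obtain ⟨p, q, rfl⟩ := h1
    obtain ⟨p', q', rfl⟩ := h2
    exact ⟨p * p' + q * q' * D, p * q' + q * p', by
      push_cast; linear_combination (q * q' : ℂ) * hs⟩
  | inv x hx h1 =>
    obtain ⟨p, q, rfl⟩ := h1
    refine ⟨p / (p ^ 2 - D * q ^ 2), -q / (p ^ 2 - D * q ^ 2), ?_⟩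
    by_cases h0 : p ^ 2 - D * q ^ 2 = 0
    · have hDq : (D : ℚ) < 0 := by exact_mod_cast hD
      have hq : q = 0 := by
        by_contra hq
        have := pow_pos (abs_pos.2 hq) 2
        rw [sq_abs] at this
        nlinarith [sq_nonneg p]
      have hp : p = 0 := by simpa [hq] using h0
      simp [hp, hq]
    · have h0' : ((p : ℂ) ^ 2 - D * (q : ℂ) ^ 2) ≠ 0 := by exact_mod_cast h0
      have hm : ((p : ℂ) + q * δ) * (p - q * δ) = (p : ℂ) ^ 2 - D * (q : ℂ) ^ 2 := by
        linear_combination (-(q : ℂ) ^ 2) * hs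
      push_cast
      refine inv_eq_of_mul_eq_one_right ?_
      rw [← div_self h0', ← hm]
      ring

lemma normSq_rat (hD : D < 0) (p q : ℚ) :
    Complex.normSq (p + q * (Complex.I * (Real.sqrt (-(D : ℝ)) : ℂ))) =
      ((p ^ 2 - D * q ^ 2 : ℚ) : ℝ) := by
  have hd : (0 : ℝ) ≤ -(D : ℝ) := by
    have : (D : ℝ) < 0 := by exact_mod_cast hD
    linarith
  have hs := Real.mul_self_sqrt hd
  rw [Complex.normSq_apply]
  simp
  linear_combination (q : ℝ) ^ 2 * hs

lemma star_mem_quadField {z : ℂ} (hz : z ∈ quadField D) : star z ∈ quadField D := by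
  induction hz using IntermediateField.adjoin_induction with
  | mem x hx =>
    rw [Set.mem_singleton_iff.1 hx]
    have := (quadField D).neg_mem
      (IntermediateField.mem_adjoin_simple_self ℚ (Complex.I * (Real.sqrt (-(D : ℝ)) : ℂ)))
    simpa using this
  | algebraMap x => simp
  | add x y hx hy h1 h2 => rw [star_add]; exact add_mem h1 h2
  | mul x y hx hy h1 h2 => rw [star_mul']; exact mul_mem h1 h2
  | inv x hx h1 => rw [star_inv₀]; exact inv_mem h1

lemma exists_int_of_isIntegral_rat {r : ℚ} (h : IsIntegral ℤ (r : ℂ)) : ∃ m : ℤ, (m : ℚ) = r := by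
  have h' : IsIntegral ℤ (algebraMap ℚ ℂ r) := by simpa using h
  rw [isIntegral_algebraMap_iff (algebraMap ℚ ℂ).injective] at h'
  obtain ⟨m, hm⟩ := IsIntegrallyClosed.isIntegral_iff.1 h'
  exact ⟨m, by simpa using hm⟩

lemma isIntegral_star {z : ℂ} (h : IsIntegral ℤ z) : IsIntegral ℤ (star z) :=
  map_isIntegral_int (starRingEnd ℂ) h

lemma exists_normSq_eq_int (hD : D < 0) {z : ℂ} (hz : z ∈ quadField D) (hi : IsIntegral ℤ z) :
    ∃ m : ℤ, Complex.normSq z = m := by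
  obtain ⟨p, q, rfl⟩ := exists_rat_of_mem_quadField hD hz
  have h1 := hi.mul (isIntegral_star hi)
  have h2 := Complex.mul_conj (p + q * (Complex.I * (Real.sqrt (-(D : ℝ)) : ℂ)))
  rw [normSq_rat hD] at h2
  rw [normSq_rat hD]
  rw [← starRingEnd_apply, h2] at h1
  obtain ⟨m, hm⟩ := exists_int_of_isIntegral_rat (r := p ^ 2 - D * q ^ 2) (by simpa using h1)
  exact ⟨m, by rw [← hm]; simp⟩

/-- The norm is a positive integer. Both the determination of the units and the discreteness of
U(F)_ℤ rest on this bound. -/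
lemma one_le_normSq (hD : D < 0) {z : ℂ} (hz : z ∈ quadField D) (hi : IsIntegral ℤ z)
    (h0 : z ≠ 0) : 1 ≤ Complex.normSq z := by
  obtain ⟨m, hm⟩ := exists_normSq_eq_int hD hz hi
  have := Complex.normSq_pos.2 h0
  rw [hm] at this ⊢
  exact_mod_cast this

/-- The units of the ring of integers of `ℚ(√D)` are `±1` for squarefree `D < -3`. -/
lemma eq_one_or_neg_one_of_isIntegral (hD : D < -3) (hsq : Squarefree D) {z : ℂ}
    (hz : z ∈ quadField D) (hi : IsIntegral ℤ z) (hi' : IsIntegral ℤ z⁻¹) (h0 : z ≠ 0) :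
    z = 1 ∨ z = -1 := by
  have hD0 : D < 0 := by omega
  have h1 := one_le_normSq hD0 hz hi h0
  have h2 := one_le_normSq hD0 (inv_mem hz) hi' (inv_ne_zero h0)
  have hn : Complex.normSq z = 1 := by
    rw [map_inv₀] at h2
    exact le_antisymm ((one_le_inv₀ (by linarith)).1 h2) h1
  have hD5 : D < -4 := by
    rcases (show D ≤ -4 by omega).lt_or_eq with h | h
    · exact h
    · subst h
      have := hsq 2 ⟨-1, by norm_num⟩
      rw [Int.isUnit_iff] at this
      omega
  have hi2 := hi.add (isIntegral_star hi)
  obtain ⟨p, q, rfl⟩ := exists_rat_of_mem_quadField hD0 hz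
  rw [normSq_rat hD0] at hn
  have hn' : p ^ 2 - D * q ^ 2 = 1 := by exact_mod_cast hn
  obtain ⟨m, hm⟩ := exists_int_of_isIntegral_rat (r := 2 * p) (by
    have e : ((2 * p : ℚ) : ℂ) = p + q * (Complex.I * (Real.sqrt (-(D : ℝ)) : ℂ)) +
        star (p + q * (Complex.I * (Real.sqrt (-(D : ℝ)) : ℂ))) := by
      rw [Complex.star_def]
      simp only [map_add, map_mul, Complex.conj_I, Complex.conj_ofReal, map_ratCast]
      push_cast
      ring
    rw [e]
    exact hi2)
  -- With trace m = 2p and norm 1, the rational number 2qD has an integral square, so it is itself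
  -- an integer k.
  have hk : (2 * q * D) ^ 2 = ((D * (m ^ 2 - 4) : ℤ) : ℚ) := by
    push_cast
    rw [hm]
    linear_combination (-4 * (D : ℚ)) * hn'
  obtain ⟨k, hk'⟩ := exists_int_of_isIntegral_rat (r := 2 * q * D) (by
    have : IsIntegral ℤ (((2 * q * D : ℚ) : ℂ) ^ 2) := by
      rw [← Rat.cast_pow, hk, Rat.cast_intCast]
      exact isIntegral_algebraMap (A := ℂ) (x := (D * (m ^ 2 - 4) : ℤ))
    exact this.of_pow (by norm_num))
  rw [← hk'] at hk
  have hk2 : k ^ 2 = D * (m ^ 2 - 4) := by exact_mod_cast hk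
  have hdvd : D ∣ k := (hsq.dvd_pow_iff_dvd (by norm_num : (2 : ℕ) ≠ 0)).1 ⟨_, hk2⟩
  obtain ⟨l, rfl⟩ := hdvd
  have hl : D * l ^ 2 = m ^ 2 - 4 := by
    apply mul_left_cancel₀ (show D ≠ 0 by omega)
    linear_combination hk2
  -- If l ≠ 0, then D l² < -4, while m² - 4 ≥ -4.
  have hl0 : l = 0 := by
    by_contra hl0
    have : 0 < l ^ 2 := by positivity
    nlinarith [sq_nonneg m]
  have hq : q = 0 := by
    rw [hl0] at hk'
    have hDq : (D : ℚ) ≠ 0 := by exact_mod_cast (show D ≠ 0 by omega)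
    simpa [hDq] using hk'.symm
  subst hq
  have hp : p ^ 2 = 1 := by simpa using hn'
  rcases eq_or_eq_neg_of_sq_eq_sq p 1 (by rw [hp, one_pow]) with rfl | rfl <;> simp

lemma exists_nat_mul_isIntegral (hD : D < 0) {z : ℂ} (hz : z ∈ quadField D) :
    ∃ m : ℕ, m ≠ 0 ∧ IsIntegral ℤ (m * z) := by
  obtain ⟨p, q, rfl⟩ := exists_rat_of_mem_quadField hD hz
  have hδ : IsIntegral ℤ (Complex.I * (Real.sqrt (-(D : ℝ)) : ℂ)) := by
    have hd : (0 : ℝ) ≤ -(D : ℝ) := by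
      have : (D : ℝ) < 0 := by exact_mod_cast hD
      linarith
    have : IsIntegral ℤ ((Complex.I * (Real.sqrt (-(D : ℝ)) : ℂ)) ^ 2) := by
      rw [mul_pow, ← Complex.ofReal_pow, Real.sq_sqrt hd, Complex.I_sq]
      push_cast
      rw [neg_mul_neg, one_mul]
      exact isIntegral_algebraMap (A := ℂ) (x := D)
    exact this.of_pow (by norm_num)
  refine ⟨p.den * q.den, by simp, ?_⟩
  have hp : (p : ℂ) * p.den = p.num := by exact_mod_cast p.mul_den_eq_num
  have hq : (q : ℂ) * q.den = q.num := by exact_mod_cast q.mul_den_eq_num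
  have e : ((p.den * q.den : ℕ) : ℂ) * (p + q * (Complex.I * (Real.sqrt (-(D : ℝ)) : ℂ))) =
      ((p.num * q.den : ℤ) : ℂ) +
        ((q.num * p.den : ℤ) : ℂ) * (Complex.I * (Real.sqrt (-(D : ℝ)) : ℂ)) := by
    push_cast
    rw [← hp, ← hq]
    ring
  rw [e]
  exact (isIntegral_algebraMap (A := ℂ) (x := (p.num * q.den : ℤ))).add
    ((isIntegral_algebraMap (A := ℂ) (x := (q.num * p.den : ℤ))).mul hδ)

lemma exists_nat_smul_isIntegral (hD : D < 0) {ι : Type*} [Fintype ι] {f : ι → ℂ}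
    (hf : ∀ i, f i ∈ quadField D) : ∃ m : ℕ, m ≠ 0 ∧ ∀ i, IsIntegral ℤ (m * f i) := by
  choose m hm hi using fun i => exists_nat_mul_isIntegral hD (hf i)
  refine ⟨∏ i, m i, Finset.prod_ne_zero_iff.2 fun i _ => hm i, fun i => ?_⟩
  obtain ⟨k, hk⟩ := Finset.dvd_prod_of_mem m (Finset.mem_univ i)
  rw [hk]
  have : (((m i * k : ℕ) : ℂ) * f i) = ((k : ℤ) : ℂ) * (m i * f i) := by push_cast; ring
  rw [this]
  exact (isIntegral_algebraMap (A := ℂ) (x := (k : ℤ))).mul (hi i)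

end Arithmetic

end BallQuotient

namespace BallQuotient

namespace HermitianLattice

variable {D : ℤ} {n : ℕ} (L : HermitianLattice D n)

/-! ### The hermitian form and its signature. -/

section Form

lemma h_add_left (x x' y : Fin (n + 1) → ℂ) : L.h (x + x') y = L.h x y + L.h x' y := by
  simp [h, Matrix.mulVec_add, dotProduct_add]

lemma h_smul_left (c : ℂ) (x y : Fin (n + 1) → ℂ) : L.h (c • x) y = c * L.h x y := by
  simp [h, Matrix.mulVec_smul, dotProduct_smul]

lemma h_add_right (x y y' : Fin (n + 1) → ℂ) : L.h x (y + y') = L.h x y + L.h x y' := by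
  simp [h, add_dotProduct]

lemma h_smul_right (c : ℂ) (x y : Fin (n + 1) → ℂ) : L.h x (c • y) = star c * L.h x y := by
  simp [h, smul_dotProduct]

lemma h_neg_left (x y : Fin (n + 1) → ℂ) : L.h (-x) y = -L.h x y := by
  simpa using L.h_smul_left (-1) x y

lemma h_neg_right (x y : Fin (n + 1) → ℂ) : L.h x (-y) = -L.h x y := by
  simpa using L.h_smul_right (-1) x y

lemma h_sub_left (x x' y : Fin (n + 1) → ℂ) : L.h (x - x') y = L.h x y - L.h x' y := by
  rw [sub_eq_add_neg, h_add_left, h_neg_left, ← sub_eq_add_neg]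

lemma h_sub_right (x y y' : Fin (n + 1) → ℂ) : L.h x (y - y') = L.h x y - L.h x y' := by
  rw [sub_eq_add_neg, h_add_right, h_neg_right, ← sub_eq_add_neg]

lemma h_zero_left (y : Fin (n + 1) → ℂ) : L.h 0 y = 0 := by
  simp [h]

lemma h_zero_right (x : Fin (n + 1) → ℂ) : L.h x 0 = 0 := by
  simp [h]

lemma star_h (x y : Fin (n + 1) → ℂ) : star (L.h x y) = L.h y x := by
  rw [h, h, Matrix.star_dotProduct, star_star, Matrix.star_mulVec, L.isHermitian.eq,
    ← Matrix.dotProduct_mulVec]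

lemma h_smul_smul_self (c : ℂ) (x : Fin (n + 1) → ℂ) :
    L.h (c • x) (c • x) = (Complex.normSq c : ℂ) * L.h x x := by
  rw [h_smul_left, h_smul_right, ← mul_assoc, Complex.star_def, Complex.mul_conj]

/-- Coordinates in which the form is `|z₁|² + ⋯ + |zₙ|² - |zₙ₊₁|²`. -/
lemma exists_diagonal_coordinates : ∃ T : (Fin (n + 1) → ℂ) →ₗ[ℂ] (Fin (n + 1) → ℂ),
    Function.Injective T ∧ ∀ x, L.h x x =
      ((∑ i : Fin n, Complex.normSq (T x i.castSucc) - Complex.normSq (T x (Fin.last n)) : ℝ) :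
        ℂ) := by
  obtain ⟨P, hP, hd⟩ := L.signature
  have hP1 : P * P⁻¹ = 1 := Matrix.mul_nonsing_inv P hP
  have key : ∀ x, P *ᵥ (P⁻¹ *ᵥ x) = x := fun x => by
    rw [Matrix.mulVec_mulVec, hP1, Matrix.one_mulVec]
  refine ⟨Matrix.mulVecLin P⁻¹, fun x y hxy => ?_, fun x => ?_⟩
  · rw [← key x, ← key y]
    exact congrArg (P *ᵥ ·) hxy
  · obtain ⟨z, rfl⟩ : ∃ z, x = P *ᵥ z := ⟨_, (key x).symm⟩
    have e1 : P⁻¹ *ᵥ (P *ᵥ z) = z := by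
      rw [Matrix.mulVec_mulVec, Matrix.nonsing_inv_mul P hP, Matrix.one_mulVec]
    rw [Matrix.mulVecLin_apply, e1]
    have e2 : L.h (P *ᵥ z) (P *ᵥ z) = star z ⬝ᵥ ((Pᴴ * L.Q * P) *ᵥ z) := by
      rw [h, Matrix.star_mulVec, ← Matrix.dotProduct_mulVec, Matrix.mulVec_mulVec,
        Matrix.mulVec_mulVec, Matrix.mul_assoc]
    rw [e2, hd, dotProduct, Fin.sum_univ_castSucc]
    have hne : ∀ i : Fin n, i.castSucc ≠ Fin.last n := fun i => (Fin.castSucc_lt_last i).ne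
    simp only [Matrix.mulVec_diagonal, hne, if_false, if_true, Pi.star_apply, one_mul, neg_one_mul,
      mul_neg, Complex.star_def]
    push_cast
    simp only [Complex.normSq_eq_conj_mul_self, sub_eq_add_neg]

/-- A matrix congruent to diag(1,…,1,-1) has nonzero determinant. -/
lemma eq_zero_of_forall_h_eq_zero {e : Fin (n + 1) → ℂ} (he : ∀ x, L.h x e = 0) : e = 0 := by
  obtain ⟨P, hP, hd⟩ := L.signature
  have hdet : IsUnit L.Q.det := by
    have h1 := congrArg Matrix.det hd
    rw [Matrix.det_mul, Matrix.det_mul, Matrix.det_diagonal] at h1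
    rw [isUnit_iff_ne_zero]
    intro h0
    rw [h0, mul_zero, zero_mul] at h1
    refine Finset.prod_ne_zero_iff.2 (fun i _ => ?_) h1.symm
    split_ifs <;> norm_num
  have h1 : L.Q *ᵥ e = 0 := by
    funext i
    have h2 : L.h e (Pi.single i 1) = 0 := by rw [← star_h, he, star_zero]
    simpa [h, ← Pi.single_star] using h2
  have h2 := congrArg (L.Q⁻¹ *ᵥ ·) h1
  simpa [Matrix.mulVec_mulVec, Matrix.nonsing_inv_mul _ hdet] using h2

/-- The form is positive semidefinite on the orthogonal complement of an isotropic vector. -/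
lemma h_self_nonneg_of_orthogonal {e v : Fin (n + 1) → ℂ} (he0 : e ≠ 0) (he : L.h e e = 0)
    (hv : L.h v e = 0) : 0 ≤ (L.h v v).re := by
  obtain ⟨T, hT, hh⟩ := L.exists_diagonal_coordinates
  have hnn : ∀ x, T x (Fin.last n) = 0 → 0 ≤ (L.h x x).re := fun x hx => by
    rw [hh, Complex.ofReal_re, hx, map_zero, sub_zero]
    exact Finset.sum_nonneg fun i _ => Complex.normSq_nonneg _
  -- Otherwise e would be an isotropic vector of a positive definite subspace.
  have hlast : T e (Fin.last n) ≠ 0 := by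
    intro h0
    rw [hh, h0, map_zero, sub_zero, Complex.ofReal_eq_zero,
      Finset.sum_eq_zero_iff_of_nonneg fun i _ => Complex.normSq_nonneg _] at he
    refine he0 (hT ?_)
    rw [map_zero]
    funext i
    refine Fin.lastCases h0 (fun j => ?_) i
    simpa using he j (Finset.mem_univ j)
  -- Subtracting this multiple of e kills the negative coordinate of v and leaves h(v,v) unchanged,
  -- as e is isotropic and orthogonal to v.
  have h1 := hnn (v - (T v (Fin.last n) / T e (Fin.last n)) • e) (by simp [hlast])
  have hv' : L.h e v = 0 := by rw [← star_h, hv, star_zero]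
  simpa [h_sub_left, h_sub_right, h_smul_left, h_smul_right, he, hv, hv'] using h1

lemma mem_realUnitary_iff {g : GL (Fin (n + 1)) ℂ} :
    g ∈ L.realUnitary ↔ ∀ x y, L.h (g.val *ᵥ x) (g.val *ᵥ y) = L.h x y := by
  have key : ∀ x y, L.h (g.val *ᵥ x) (g.val *ᵥ y) =
      star y ⬝ᵥ (((g.val)ᴴ * L.Q * g.val) *ᵥ x) := fun x y => by
    rw [h, Matrix.star_mulVec, ← Matrix.dotProduct_mulVec, Matrix.mulVec_mulVec,
        Matrix.mulVec_mulVec, Matrix.mul_assoc]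
  change (g.val)ᴴ * L.Q * g.val = L.Q ↔ _
  constructor
  · intro hg x y
    rw [key, hg, h]
  · intro hg
    ext i j
    have := hg (Pi.single j 1) (Pi.single i 1)
    rw [key, h] at this
    simpa [← Pi.single_star] using this

end Form

/-! ### Eichler transvections, W(F) and its centre. -/

section Transvection

/-- The matrix of `z ↦ z + h(z,e) v - h(z,v) e + (c - h(v,v)/2) h(z,e) e`. -/
noncomputable def eichlerMatrix (e v : Fin (n + 1) → ℂ) (c : ℂ) :
    Matrix (Fin (n + 1)) (Fin (n + 1)) ℂ :=
  1 + Matrix.vecMulVec v (star e ᵥ* L.Q) - Matrix.vecMulVec e (star v ᵥ* L.Q) +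
    (c - L.h v v / 2) • Matrix.vecMulVec e (star e ᵥ* L.Q)

lemma vecMulVec_mulVec_eq_h_smul (v e z : Fin (n + 1) → ℂ) :
    Matrix.vecMulVec v (star e ᵥ* L.Q) *ᵥ z = L.h z e • v := by
  rw [Matrix.vecMulVec_mulVec, ← Matrix.dotProduct_mulVec]
  ext i
  simp [h, mul_comm]

lemma eichlerMatrix_mulVec (e v : Fin (n + 1) → ℂ) (c : ℂ) (z : Fin (n + 1) → ℂ) :
    L.eichlerMatrix e v c *ᵥ z =
      z + L.h z e • v - L.h z v • e + ((c - L.h v v / 2) * L.h z e) • e := by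
  rw [eichlerMatrix, Matrix.add_mulVec, Matrix.sub_mulVec, Matrix.add_mulVec, Matrix.smul_mulVec,
    vecMulVec_mulVec_eq_h_smul, vecMulVec_mulVec_eq_h_smul, vecMulVec_mulVec_eq_h_smul,
    Matrix.one_mulVec, smul_smul]

/-- The parameters (v, c) compose as in a Heisenberg group, with cocycle i·Im h, which vanishes on
the pair v, -v. -/
lemma eichlerMatrix_mul_neg {e v : Fin (n + 1) → ℂ} (he : L.h e e = 0) (hv : L.h v e = 0)
    (c : ℂ) : L.eichlerMatrix e v c * L.eichlerMatrix e (-v) (-c) = 1 := by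
  have hv' : L.h e v = 0 := by rw [← star_h, hv, star_zero]
  refine Matrix.toLin'.injective (LinearMap.ext fun z => ?_)
  rw [Matrix.toLin'_apply, Matrix.toLin'_apply, ← Matrix.mulVec_mulVec, Matrix.one_mulVec,
    eichlerMatrix_mulVec, eichlerMatrix_mulVec]
  simp only [h_add_left, h_sub_left, h_smul_left, h_neg_left, h_neg_right, he, hv, hv']
  ext i
  simp
  ring

/-- The Eichler transvection `z ↦ z + h(z,e) v - h(z,v) e + (c - h(v,v)/2) h(z,e) e`. -/
noncomputable def eichler {e v : Fin (n + 1) → ℂ} (he : L.h e e = 0) (hv : L.h v e = 0) (c : ℂ) :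
    GL (Fin (n + 1)) ℂ where
  val := L.eichlerMatrix e v c
  inv := L.eichlerMatrix e (-v) (-c)
  val_inv := L.eichlerMatrix_mul_neg he hv c
  inv_val := by
    have := L.eichlerMatrix_mul_neg he (v := -v) (by rw [h_neg_left, hv, neg_zero]) (-c)
    rwa [neg_neg, neg_neg] at this

lemma eichler_mulVec {e v : Fin (n + 1) → ℂ} (he : L.h e e = 0) (hv : L.h v e = 0) (c : ℂ)
    (z : Fin (n + 1) → ℂ) : (L.eichler he hv c).val *ᵥ z =
      z + L.h z e • v - L.h z v • e + ((c - L.h v v / 2) * L.h z e) • e :=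
  L.eichlerMatrix_mulVec e v c z

lemma eichler_mulVec_self {e v : Fin (n + 1) → ℂ} (he : L.h e e = 0) (hv : L.h v e = 0) (c : ℂ) :
    (L.eichler he hv c).val *ᵥ e = e := by
  have hv' : L.h e v = 0 := by rw [← star_h, hv, star_zero]
  simp [eichler_mulVec, he, hv']

lemma eichler_mem_realUnitary {e v : Fin (n + 1) → ℂ} (he : L.h e e = 0) (hv : L.h v e = 0)
    {c : ℂ} (hc : star c = -c) : L.eichler he hv c ∈ L.realUnitary := by
  have hv' : L.h e v = 0 := by rw [← star_h, hv, star_zero]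
  rw [mem_realUnitary_iff]
  intro x y
  simp only [eichler_mulVec, h_add_left, h_sub_left, h_smul_left, h_add_right, h_sub_right,
    h_smul_right, he, hv, hv', star_mul', star_sub, star_h, hc, star_div₀, star_ofNat]
  ring

lemma isNilpotent_eichler_sub_one {e v : Fin (n + 1) → ℂ} (he : L.h e e = 0) (hv : L.h v e = 0)
    (c : ℂ) : IsNilpotent ((L.eichler he hv c).val - 1) := by
  have hv' : L.h e v = 0 := by rw [← star_h, hv, star_zero]
  -- T - 1 maps everything into the span of v and e, maps v into the line of e, and kills e.
  refine ⟨3, Matrix.toLin'.injective (LinearMap.ext fun z => ?_)⟩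
  have key : ∀ z, ((L.eichler he hv c).val - 1) *ᵥ z =
      L.h z e • v - L.h z v • e + ((c - L.h v v / 2) * L.h z e) • e := fun z => by
    rw [Matrix.sub_mulVec, eichler_mulVec, Matrix.one_mulVec]
    abel
  rw [Matrix.toLin'_apply, pow_three, ← Matrix.mulVec_mulVec, ← Matrix.mulVec_mulVec, key, key, key]
  simp only [h_add_left, h_sub_left, h_smul_left, he, hv, hv']
  simp

lemma eichler_mem_N {e v : Fin (n + 1) → ℂ} (he : L.h e e = 0) (hv : L.h v e = 0)
    {c : ℂ} (hc : star c = -c) : L.eichler he hv c ∈ L.N (Submodule.span ℂ {e}) := by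
  refine ⟨L.eichler_mem_realUnitary he hv hc, ?_⟩
  rw [Submodule.map_span, Set.image_singleton, Matrix.mulVecLin_apply, eichler_mulVec_self]

lemma eichler_mem_W {e v : Fin (n + 1) → ℂ} (he : L.h e e = 0) (hv : L.h v e = 0)
    {c : ℂ} (hc : star c = -c) : L.eichler he hv c ∈ L.W (Submodule.span ℂ {e}) :=
  Subgroup.subset_closure ⟨L.eichler_mem_N he hv hc, L.isNilpotent_eichler_sub_one he hv c⟩

lemma exists_mulVec_eq_smul {e : Fin (n + 1) → ℂ} {g : GL (Fin (n + 1)) ℂ}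
    (hg : g ∈ L.N (Submodule.span ℂ {e})) : ∃ u : ℂ, g.val *ᵥ e = u • e := by
  have h1 : Matrix.mulVecLin g.val e ∈ Submodule.span ℂ {e} := by
    rw [← hg.2]
    exact ⟨e, Submodule.mem_span_singleton_self e, rfl⟩
  obtain ⟨u, hu⟩ := Submodule.mem_span_singleton.1 h1
  exact ⟨u, hu.symm⟩

lemma inv_mulVec_mulVec (g : GL (Fin (n + 1)) ℂ) (x : Fin (n + 1) → ℂ) :
    (g⁻¹).val *ᵥ (g.val *ᵥ x) = x := by
  rw [Matrix.mulVec_mulVec, g.inv_mul, Matrix.one_mulVec]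

/-- A unipotent generator has e as an eigenvector, and its eigenvalue must be 1 because g - 1 is
nilpotent. Fixing e passes to products and inverses. -/
lemma mulVec_eq_self_of_mem_W {e : Fin (n + 1) → ℂ} {g : GL (Fin (n + 1)) ℂ}
    (hg : g ∈ L.W (Submodule.span ℂ {e})) : g.val *ᵥ e = e := by
  induction hg using Subgroup.closure_induction with
  | mem g hg =>
    obtain ⟨u, hu⟩ := L.exists_mulVec_eq_smul hg.1
    obtain ⟨k, hk⟩ := hg.2
    have h1 : ∀ m : ℕ, ((g.val - 1) ^ m) *ᵥ e = (u - 1) ^ m • e := fun m => by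
      induction m with
      | zero => simp
      | succ m ih =>
        rw [pow_succ, ← Matrix.mulVec_mulVec, Matrix.sub_mulVec, hu, Matrix.one_mulVec,
          show u • e - e = (u - 1) • e by rw [sub_smul, one_smul], Matrix.mulVec_smul, ih, smul_smul, pow_succ']
    have h2 := h1 k
    rw [hk, Matrix.zero_mulVec] at h2
    rcases smul_eq_zero.1 h2.symm with h3 | h3
    · rw [hu, sub_eq_zero.1 (eq_zero_of_pow_eq_zero h3), one_smul]
    · rw [h3, Matrix.mulVec_zero]
  | one => simp
  | mul x y _ _ hx hy =>
    rw [Units.val_mul, ← Matrix.mulVec_mulVec, hy, hx]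
  | inv x _ hx =>
    have := inv_mulVec_mulVec x e
    rwa [hx] at this

lemma W_le_N (E : Submodule ℂ (Fin (n + 1) → ℂ)) : L.W E ≤ L.N E :=
  (Subgroup.closure_le _).2 fun _ hg => hg.1

/-- A transvection `z ↦ z + c h(z,e) e` in `N(F)` is central in `W(F)`. -/
lemma mem_U_of_transvection {e : Fin (n + 1) → ℂ} (he : L.h e e = 0) {g : GL (Fin (n + 1)) ℂ}
    (hg : g ∈ L.N (Submodule.span ℂ {e})) {c : ℂ}
    (hgc : ∀ z, g.val *ᵥ z = z + (c * L.h z e) • e) : g ∈ L.U (Submodule.span ℂ {e}) := by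
  refine ⟨Subgroup.subset_closure ⟨hg, 2, ?_⟩, ?_⟩
  · refine Matrix.toLin'.injective (LinearMap.ext fun z => ?_)
    have key : ∀ z, (g.val - 1) *ᵥ z = (c * L.h z e) • e := fun z => by
      rw [Matrix.sub_mulVec, hgc, Matrix.one_mulVec, add_sub_cancel_left]
    rw [Matrix.toLin'_apply, pow_two, ← Matrix.mulVec_mulVec, key, key, h_smul_left, he]
    simp
  · change g ∈ Subgroup.centralizer (L.W (Submodule.span ℂ {e}) : Set (GL (Fin (n + 1)) ℂ))
    rw [Subgroup.mem_centralizer_iff]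
    intro k hk
    have hke := L.mulVec_eq_self_of_mem_W hk
    refine Units.ext (Matrix.toLin'.injective (LinearMap.ext fun z => ?_))
    rw [Matrix.toLin'_apply, Matrix.toLin'_apply, Units.val_mul, Units.val_mul,
      ← Matrix.mulVec_mulVec, ← Matrix.mulVec_mulVec, hgc, hgc, Matrix.mulVec_add,
      Matrix.mulVec_smul, hke]
    -- As k preserves h and fixes e, it satisfies h(kz, e) = h(z, e), which is what commutation
    -- comes down to.
    have := L.mem_realUnitary_iff.1 (L.W_le_N _ hk).1 z e
    rw [hke] at this
    rw [this]

/-- The centre of `W(F)` fixes the orthogonal complement of the cusp. -/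
lemma mulVec_eq_self_of_mem_U {e : Fin (n + 1) → ℂ} (he0 : e ≠ 0) (he : L.h e e = 0)
    {g : GL (Fin (n + 1)) ℂ} (hg : g ∈ L.U (Submodule.span ℂ {e})) {v : Fin (n + 1) → ℂ}
    (hv : L.h v e = 0) : g.val *ᵥ v = v := by
  obtain ⟨hgW, hgC⟩ := hg
  change g ∈ Subgroup.centralizer (L.W (Submodule.span ℂ {e}) : Set (GL (Fin (n + 1)) ℂ)) at hgC
  rw [Subgroup.mem_centralizer_iff] at hgC
  have hge := L.mulVec_eq_self_of_mem_W hgW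
  have hgu := L.mem_realUnitary_iff.1 (L.W_le_N _ hgW).1
  obtain ⟨l, hl⟩ : ∃ l, L.h l e ≠ 0 := by
    by_contra! hcon
    exact he0 (L.eq_zero_of_forall_h_eq_zero hcon)
  -- Commuting with the transvection of parameters (v, 0), evaluated at l, shows that gv - v is a
  -- multiple of e. Unitarity on the pair l, v then makes the coefficient equal to its conjugate.
  have main : ∀ v, L.h v e = 0 → ∃ r : ℝ, g.val *ᵥ v = v + (r : ℂ) • e := by
    intro v hv
    have hc := hgC _ (L.eichler_mem_W he hv (c := 0) (by simp))
    have hc' := congrArg (fun x : GL (Fin (n + 1)) ℂ => x.val *ᵥ l) hc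
    simp only [Units.val_mul, ← Matrix.mulVec_mulVec, eichler_mulVec, Matrix.mulVec_add,
      Matrix.mulVec_sub, Matrix.mulVec_smul, hge] at hc'
    have hgle : L.h (g.val *ᵥ l) e = L.h l e := by simpa [hge] using hgu l e
    rw [hgle] at hc'
    have hsub : L.h l e • (g.val *ᵥ v) =
        L.h l e • v + (L.h l v - L.h (g.val *ᵥ l) v) • e := by
      rw [sub_smul]
      linear_combination (exp := 1) -hc'
    have hgv : g.val *ᵥ v = v + ((L.h l v - L.h (g.val *ᵥ l) v) / L.h l e) • e := by
      apply smul_right_injective _ hl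
      simp only
      rw [hsub, smul_add, smul_smul, mul_div_cancel₀ _ hl]
    set q := (L.h l v - L.h (g.val *ᵥ l) v) / L.h l e with hq
    have h1 : L.h l v = L.h (g.val *ᵥ l) v + star q * L.h l e := by
      rw [← hgu l v, hgv, h_add_right, h_smul_right, hgle]
    have h2 : q = star q := by
      rw [hq]
      nth_rewrite 1 [h1]
      field_simp
      ring
    exact ⟨q.re, by rw [hgv, Complex.conj_eq_iff_re.1 h2.symm]⟩
  obtain ⟨r, hr⟩ := main v hv
  -- Applied to iv, the same argument makes i·r real as well, so r = 0.
  obtain ⟨r', hr'⟩ := main (Complex.I • v) (by rw [h_smul_left, hv, mul_zero])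
  rw [Matrix.mulVec_smul, hr, smul_add, smul_smul] at hr'
  have h3 := smul_left_injective ℂ he0 (add_left_cancel hr')
  have hr0 : r = 0 := by simpa using congrArg Complex.im h3
  rw [hr, hr0, Complex.ofReal_zero, zero_smul, add_zero]

end Transvection

end HermitianLattice

end BallQuotient

namespace BallQuotient

namespace HermitianLattice

variable {D : ℤ} {n : ℕ} (L : HermitianLattice D n)

/-! ### Integrality of U(Λ) and its action on the cusp. -/

section Lattice

variable {L}

lemma isIntegral_algebraMap_ringOfIntegers
    (x : NumberField.RingOfIntegers (quadField D)) :
    IsIntegral ℤ (algebraMap (NumberField.RingOfIntegers (quadField D)) ℂ x) :=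
  (NumberField.RingOfIntegers.isIntegral x).algebraMap

lemma exists_algebraMap_ringOfIntegers_eq {z : ℂ} (hz : z ∈ quadField D) (hi : IsIntegral ℤ z) :
    ∃ x : NumberField.RingOfIntegers (quadField D),
      algebraMap (NumberField.RingOfIntegers (quadField D)) ℂ x = z := by
  have h1 : IsIntegral ℤ (⟨z, hz⟩ : quadField D) :=
    (isIntegral_algebraMap_iff (algebraMap (quadField D) ℂ).injective).1 hi
  exact ⟨⟨⟨z, hz⟩, h1⟩, rfl⟩

lemma apply_mem_quadField {g : GL (Fin (n + 1)) ℂ} (hg : g ∈ L.latticeUnitary)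
    (i j : Fin (n + 1)) : g.val i j ∈ quadField D := by
  obtain ⟨⟨G, rfl⟩, -⟩ := hg
  exact (G.val i j).1.2

lemma isIntegral_apply {g : GL (Fin (n + 1)) ℂ} (hg : g ∈ L.latticeUnitary)
    (i j : Fin (n + 1)) : IsIntegral ℤ (g.val i j) := by
  obtain ⟨⟨G, rfl⟩, -⟩ := hg
  exact isIntegral_algebraMap_ringOfIntegers (G.val i j)

lemma mem_latticeUnitary_of_isIntegral {g : GL (Fin (n + 1)) ℂ} (hg : g ∈ L.realUnitary)
    (h1 : ∀ i j, g.val i j ∈ quadField D ∧ IsIntegral ℤ (g.val i j))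
    (h2 : ∀ i j, (g⁻¹).val i j ∈ quadField D ∧ IsIntegral ℤ ((g⁻¹).val i j)) :
    g ∈ L.latticeUnitary := by
  refine ⟨?_, hg⟩
  choose A hA using fun i j => exists_algebraMap_ringOfIntegers_eq (h1 i j).1 (h1 i j).2
  choose B hB using fun i j => exists_algebraMap_ringOfIntegers_eq (h2 i j).1 (h2 i j).2
  set f := algebraMap (NumberField.RingOfIntegers (quadField D)) ℂ
  have hf : Function.Injective f := FaithfulSMul.algebraMap_injective _ _
  have hA' : (Matrix.of A).map f = g.val := by ext i j; exact hA i j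
  have hB' : (Matrix.of B).map f = (g⁻¹).val := by ext i j; exact hB i j
  refine ⟨⟨Matrix.of A, Matrix.of B, ?_, ?_⟩, Units.ext hA'⟩
  · apply Matrix.map_injective hf
    dsimp only
    rw [Matrix.map_mul, hA', hB', g.mul_inv, Matrix.map_one f (map_zero f) (map_one f)]
  · apply Matrix.map_injective hf
    dsimp only
    rw [Matrix.map_mul, hA', hB', g.inv_mul, Matrix.map_one f (map_zero f) (map_one f)]

/-- The eigenvalue is a root of a monic characteristic polynomial over 𝒪, and 𝒪 is integral over ℤ.
-/
lemma isIntegral_eigenvalue {g : GL (Fin (n + 1)) ℂ} (hg : g ∈ L.latticeUnitary)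
    {e : Fin (n + 1) → ℂ} (he0 : e ≠ 0) {u : ℂ} (hu : g.val *ᵥ e = u • e) : IsIntegral ℤ u := by
  obtain ⟨⟨G, rfl⟩, -⟩ := hg
  set f := algebraMap (NumberField.RingOfIntegers (quadField D)) ℂ with hf
  have hG : (Matrix.GeneralLinearGroup.map f G).val = G.val.map f := rfl
  have h1 : IsIntegral (NumberField.RingOfIntegers (quadField D)) u := by
    refine ⟨G.val.charpoly, Matrix.charpoly_monic _, ?_⟩
    rw [← hf, ← Polynomial.eval_map, ← Matrix.charpoly_map, Matrix.eval_charpoly,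
      ← Matrix.exists_mulVec_eq_zero_iff]
    refine ⟨e, he0, ?_⟩
    rw [Matrix.sub_mulVec, ← hG, hu]
    ext i
    simp [Matrix.scalar_apply]
  exact isIntegral_trans u h1

lemma mulVec_mem_quadField {g : GL (Fin (n + 1)) ℂ} (hg : g ∈ L.latticeUnitary)
    {e : Fin (n + 1) → ℂ} (he : ∀ i, e i ∈ quadField D) (i : Fin (n + 1)) :
    (g.val *ᵥ e) i ∈ quadField D := by
  rw [Matrix.mulVec, dotProduct]
  exact sum_mem fun j _ => mul_mem (apply_mem_quadField hg i j) (he j)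

/-- Integral elements of `N(F)` act on the rational isotropic line by `±1`. -/
lemma mulVec_eq_or_eq_neg (hD : D < -3) (hsq : Squarefree D) {g : GL (Fin (n + 1)) ℂ}
    (hg : g ∈ L.latticeUnitary) {e : Fin (n + 1) → ℂ} (he0 : e ≠ 0)
    (he : ∀ i, e i ∈ quadField D) (hgN : g ∈ L.N (Submodule.span ℂ {e})) :
    ∃ ε : ℂ, (ε = 1 ∨ ε = -1) ∧ g.val *ᵥ e = ε • e := by
  obtain ⟨u, hu⟩ := L.exists_mulVec_eq_smul hgN
  have h1 : e = u • ((g⁻¹).val *ᵥ e) := by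
    rw [← Matrix.mulVec_smul, ← hu, inv_mulVec_mulVec]
  have hu0 : u ≠ 0 := by
    rintro rfl
    exact he0 (by rw [h1, zero_smul])
  have hu' : (g⁻¹).val *ᵥ e = u⁻¹ • e := by
    conv_rhs => rw [h1]
    rw [smul_smul, inv_mul_cancel₀ hu0, one_smul]
  obtain ⟨i, hi⟩ := Function.ne_iff.1 he0
  have huK : u ∈ quadField D := by
    have h2 : u = (g.val *ᵥ e) i / e i := by
      rw [hu, Pi.smul_apply, smul_eq_mul, mul_div_cancel_right₀ _ hi]
    rw [h2]
    exact div_mem (mulVec_mem_quadField hg he i) (he i)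
  -- The inverse also lies in U(Λ), so u⁻¹ is integral too and u is a unit of 𝒪.
  exact ⟨u, eq_one_or_neg_one_of_isIntegral hD hsq huK (isIntegral_eigenvalue hg he0 hu)
    (isIntegral_eigenvalue (inv_mem hg) he0 hu') hu0, hu⟩

end Lattice

/-! ### U(F)_ℤ as a discrete group of translations. -/

namespace AdaptedBasis

variable {L} {E : Submodule ℂ (Fin (n + 1) → ℂ)} (b : L.AdaptedBasis E)

/-- The basis vector `b₁` spanning the cusp. -/
noncomputable abbrev first : Fin (n + 1) → ℂ := b.basis (.inl ())

/-- The basis vectors `b₂, …, bₙ`. -/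
noncomputable abbrev mid (i : Fin (n - 1)) : Fin (n + 1) → ℂ := b.basis (.inr (.inl i))

/-- The basis vector `bₙ₊₁`. -/
noncomputable abbrev last : Fin (n + 1) → ℂ := b.basis (.inr (.inr ()))

lemma h_mid_first (i : Fin (n - 1)) : L.h (b.mid i) b.first = 0 := by
  rw [← star_h, b.first_mid, star_zero]

/-- b₁ is orthogonal to every basis vector except the last. This expresses the denominator of α and
w by the form, which unitary maps preserve. -/
lemma h_left_first (x : Fin (n + 1) → ℂ) :
    L.h x b.first = b.basis.repr x (.inr (.inr ())) * b.a := by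
  let f : (Fin (n + 1) → ℂ) →ₗ[ℂ] ℂ :=
    { toFun := fun z => L.h z b.first
      map_add' := fun _ _ => L.h_add_left _ _ _
      map_smul' := fun _ _ => L.h_smul_left _ _ _ }
  have hf : f = b.a • b.basis.coord (.inr (.inr ())) := by
    refine b.basis.ext fun i => ?_
    rcases i with ⟨⟩ | i | ⟨⟩
    · simp [f, b.first_first]
    · simpa [f] using b.h_mid_first i
    · simp [f, a]
  have := congrArg (fun k : (Fin (n + 1) → ℂ) →ₗ[ℂ] ℂ => k x) hf
  simpa [f, mul_comm] using this

lemma a_ne_zero : b.a ≠ 0 := fun h0 =>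
  b.basis.ne_zero (.inl ()) (L.eq_zero_of_forall_h_eq_zero fun x => by
    rw [b.h_left_first, h0, mul_zero])

lemma h_last_first : L.h b.last b.first = b.a := rfl

lemma h_first_last : L.h b.first b.last = star b.a := by
  rw [← star_h, h_last_first]

lemma mulVec_first_of_mem_U {g : GL (Fin (n + 1)) ℂ} (hg : g ∈ L.U E) :
    g.val *ᵥ b.first = b.first := by
  rw [← b.span_first] at hg
  exact L.mulVec_eq_self_of_mem_W hg.1

lemma mem_realUnitary_of_mem_U {g : GL (Fin (n + 1)) ℂ} (hg : g ∈ L.U E) : g ∈ L.realUnitary :=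
  (L.W_le_N _ hg.1).1

/-- `U(F)` consists of the transvections `z ↦ z + i x h(z, b₁) b₁` with `x` real. -/
lemma exists_transvection_of_mem_U {g : GL (Fin (n + 1)) ℂ} (hg : g ∈ L.U E) :
    ∃ x : ℝ, ∀ z, g.val *ᵥ z = z + (Complex.I * x * L.h z b.first) • b.first := by
  have hgE := b.mulVec_first_of_mem_U hg
  have hgu := L.mem_realUnitary_iff.1 (mem_realUnitary_of_mem_U hg)
  have hfix : ∀ v, L.h v b.first = 0 → g.val *ᵥ v = v := fun v hv => by
    rw [← b.span_first] at hg
    exact L.mulVec_eq_self_of_mem_U (b.basis.ne_zero _) b.first_first hg hv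
  have ha := b.a_ne_zero
  have hdec : ∀ z, L.h (z - b.basis.repr z (.inr (.inr ())) • b.last) b.first = 0 := fun z => by
    rw [h_sub_left, h_smul_left, b.h_left_first, h_last_first, sub_self]
  obtain ⟨c, hc⟩ : ∃ c : ℂ, g.val *ᵥ b.last = b.last + c • b.first := by
    -- Since g fixes b₁^⊥, y is orthogonal to b₁^⊥ and hence a multiple of b₁. Pairing with bₙ₊₁
    -- determines the coefficient.
    set y := g.val *ᵥ b.last - b.last with hy
    have hyv : ∀ v, L.h v b.first = 0 → L.h v y = 0 := fun v hv => by
      rw [hy, h_sub_right]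
      nth_rewrite 1 [← hfix v hv]
      rw [hgu, sub_self]
    refine ⟨L.h y b.last / star b.a, ?_⟩
    rw [← sub_eq_iff_eq_add', ← hy, ← sub_eq_zero]
    refine L.eq_zero_of_forall_h_eq_zero fun z => ?_
    have h1 : L.h b.last (y - (L.h y b.last / star b.a) • b.first) = 0 := by
      rw [h_sub_right, h_smul_right, h_last_first, star_div₀, star_star, star_h,
        div_mul_cancel₀ _ ha, sub_self]
    have h2 := hdec z
    rw [← sub_add_cancel z (b.basis.repr z (.inr (.inr ())) • b.last), h_add_left, h_smul_left, h1,
      mul_zero, add_zero, h_sub_right, h_smul_right, h2, hyv _ h2, mul_zero, sub_zero]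
  have hz : ∀ z, g.val *ᵥ z = z + (c / b.a * L.h z b.first) • b.first := fun z => by
    nth_rewrite 1 [← sub_add_cancel z (b.basis.repr z (.inr (.inr ())) • b.last)]
    rw [Matrix.mulVec_add, hfix _ (hdec z), Matrix.mulVec_smul, hc, smul_add, smul_smul,
      ← add_assoc, sub_add_cancel, b.h_left_first]
    congr 2
    field_simp
  -- This is the invariance of h(bₙ₊₁, bₙ₊₁) = 0.
  have him : (c / b.a).re = 0 := by
    have h1 := hgu b.last b.last
    rw [hz b.last] at h1
    simp only [h_add_left, h_add_right, h_smul_left, h_smul_right, h_last_first, h_first_last,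
      b.last_last, b.first_first, star_mul'] at h1
    have h2 : (c / b.a + star (c / b.a)) * (b.a * star b.a) = 0 := by linear_combination h1
    have h3 : c / b.a + star (c / b.a) = 0 :=
      (mul_eq_zero.1 h2).resolve_right (mul_ne_zero ha (star_ne_zero.2 ha))
    have h4 := congrArg Complex.re h3
    simp only [Complex.add_re, Complex.star_def, Complex.conj_re, Complex.zero_re] at h4
    linarith
  refine ⟨(c / b.a).im, fun z => ?_⟩
  rw [hz, show Complex.I * ((c / b.a).im : ℂ) = c / b.a by
    apply Complex.ext <;> simp [him]]

variable (Γ : Subgroup (GL (Fin (n + 1)) ℂ))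

/-- The real numbers `x` for which the transvection `bₙ₊₁ ↦ bₙ₊₁ + i a x b₁` lies in `U(F)_ℤ`. -/
noncomputable def translations : AddSubgroup ℝ where
  carrier := {x | ∃ g ∈ L.UZ Γ E,
    g.val *ᵥ b.last = b.last + (Complex.I * b.a * x) • b.first}
  zero_mem' := ⟨1, one_mem _, by simp⟩
  add_mem' := by
    rintro x y ⟨g, hg, hgx⟩ ⟨g', hg', hgy⟩
    refine ⟨g * g', mul_mem hg hg', ?_⟩
    rw [Units.val_mul, ← Matrix.mulVec_mulVec, hgy, Matrix.mulVec_add, Matrix.mulVec_smul, hgx,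
      b.mulVec_first_of_mem_U hg.1, add_assoc, ← add_smul]
    push_cast
    ring_nf
  neg_mem' := by
    rintro x ⟨g, hg, hgx⟩
    refine ⟨g⁻¹, inv_mem hg, ?_⟩
    have h1 := inv_mulVec_mulVec g b.last
    have h2 := b.mulVec_first_of_mem_U (inv_mem hg.1)
    rw [hgx, Matrix.mulVec_add, Matrix.mulVec_smul, h2] at h1
    rw [eq_sub_of_add_eq h1, sub_eq_add_neg, ← neg_smul]
    push_cast
    ring_nf

variable {Γ}

lemma mem_translations_of_transvection {g : GL (Fin (n + 1)) ℂ} (hg : g ∈ L.UZ Γ E) {x : ℝ}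
    (hx : ∀ z, g.val *ᵥ z = z + (Complex.I * x * L.h z b.first) • b.first) :
    x ∈ b.translations Γ :=
  ⟨g, hg, by rw [hx, h_last_first, mul_right_comm]⟩

lemma val_eq_of_transvection {g : Matrix (Fin (n + 1)) (Fin (n + 1)) ℂ} {c : ℂ}
    {e : Fin (n + 1) → ℂ} (hx : ∀ z, g *ᵥ z = z + (c * L.h z e) • e) :
    g = 1 + c • Matrix.vecMulVec e (star e ᵥ* L.Q) := by
  refine Matrix.toLin'.injective (LinearMap.ext fun z => ?_)
  rw [Matrix.toLin'_apply, Matrix.toLin'_apply, hx, Matrix.add_mulVec, Matrix.smul_mulVec,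
    vecMulVec_mulVec_eq_h_smul, Matrix.one_mulVec, smul_smul]

lemma vecMulVec_mem_quadField {e : Fin (n + 1) → ℂ} (he : ∀ i, e i ∈ quadField D)
    (i j : Fin (n + 1)) : Matrix.vecMulVec e (star e ᵥ* L.Q) i j ∈ quadField D := by
  rw [Matrix.vecMulVec_apply, Matrix.vecMul, dotProduct]
  exact mul_mem (he i)
    (sum_mem fun k _ => mul_mem (star_mem_quadField (he k)) (L.entry_mem k j))

/-- The entries of g - 1 = i x M lie in 𝒪. A fixed nonzero entry of M thus gives |x|·|M i j| ≥ 1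
whenever x ≠ 0. -/
lemma exists_pos_le_abs_of_mem_translations (hD : D < 0) (hΓ : Γ ≤ L.latticeUnitary) :
    ∃ δ : ℝ, 0 < δ ∧ ∀ x ∈ b.translations Γ, x ≠ 0 → δ ≤ |x| := by
  set M := Matrix.vecMulVec b.first (star b.first ᵥ* L.Q) with hM
  obtain ⟨i, j, hij⟩ : ∃ i j, M i j ≠ 0 := by
    by_contra! hcon
    have h1 := vecMulVec_mulVec_eq_h_smul L b.first b.first b.last
    rw [← hM, show M = 0 from Matrix.ext hcon, Matrix.zero_mulVec, h_last_first] at h1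
    exact smul_ne_zero b.a_ne_zero (b.basis.ne_zero _) h1.symm
  refine ⟨1 / ‖M i j‖, by positivity, ?_⟩
  rintro x ⟨g, hg, hgx⟩ hx0
  obtain ⟨x', hx'⟩ := b.exists_transvection_of_mem_U hg.1
  have hxx : x' = x := by
    have h1 := hx' b.last
    rw [hgx, h_last_first] at h1
    have h2 := smul_left_injective ℂ (b.basis.ne_zero (.inl ())) (add_left_cancel h1)
    have h3 : (Complex.I * b.a) * (x : ℂ) = (Complex.I * b.a) * x' := by linear_combination h2
    exact_mod_cast (mul_left_cancel₀ (mul_ne_zero Complex.I_ne_zero b.a_ne_zero) h3).symm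
  subst hxx
  have hgL := hΓ hg.2
  have h1 := congrArg (fun A : Matrix (Fin (n + 1)) (Fin (n + 1)) ℂ => A i j)
    (val_eq_of_transvection hx')
  simp only [Matrix.add_apply, Matrix.smul_apply, smul_eq_mul, ← hM] at h1
  have h2 : Complex.I * x' * M i j = g.val i j - (1 : Matrix (Fin (n + 1)) (Fin (n + 1)) ℂ) i j := by
    rw [h1]; ring
  have h3 : (1 : Matrix (Fin (n + 1)) (Fin (n + 1)) ℂ) i j ∈ quadField D ∧
      IsIntegral ℤ ((1 : Matrix (Fin (n + 1)) (Fin (n + 1)) ℂ) i j) := by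
    rw [Matrix.one_apply]
    split_ifs
    · exact ⟨one_mem _, isIntegral_one⟩
    · exact ⟨zero_mem _, isIntegral_zero⟩
  have h4 := one_le_normSq hD (z := Complex.I * x' * M i j)
    (h2 ▸ sub_mem (apply_mem_quadField hgL i j) h3.1)
    (h2 ▸ (isIntegral_apply hgL i j).sub h3.2)
    (mul_ne_zero (mul_ne_zero Complex.I_ne_zero (Complex.ofReal_ne_zero.2 hx0)) hij)
  rw [Complex.normSq_eq_norm_sq] at h4
  have h5 : 1 ≤ ‖Complex.I * x' * M i j‖ := (one_le_sq_iff₀ (norm_nonneg _)).1 h4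
  rw [norm_mul, norm_mul, Complex.norm_I, one_mul, Complex.norm_real, Real.norm_eq_abs] at h5
  rw [div_le_iff₀ (norm_pos_iff.2 hij)]
  exact h5

/-- The factor √D makes the transvection coefficient purely imaginary, as unitarity requires, while
staying in K. A natural number m clears denominators, so 1 ± m√D M is integral, and finite index
puts a positive power in Γ. -/
lemma exists_pos_mem_translations (hD : D < 0) (hfin : Γ.IsFiniteRelIndex L.latticeUnitary) :
    ∃ x ∈ b.translations Γ, 0 < x := by
  have hd : (0 : ℝ) < -(D : ℝ) := by
    have : (D : ℝ) < 0 := by exact_mod_cast hD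
    linarith
  set M := Matrix.vecMulVec b.first (star b.first ᵥ* L.Q) with hM
  set δ : ℂ := Complex.I * (Real.sqrt (-(D : ℝ)) : ℂ) with hδ
  have hδK : δ ∈ quadField D := IntermediateField.mem_adjoin_simple_self ℚ _
  have hMK : ∀ i j, M i j ∈ quadField D := vecMulVec_mem_quadField (b.rational _)
  obtain ⟨m, hm, hmi⟩ := exists_nat_smul_isIntegral hD
    (f := fun p : Fin (n + 1) × Fin (n + 1) => δ * M p.1 p.2) fun p => mul_mem hδK (hMK p.1 p.2)
  have h0 : L.h 0 b.first = 0 := L.h_zero_left _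
  have hTz : ∀ c z, (L.eichler b.first_first h0 c).val *ᵥ z =
      z + (c * L.h z b.first) • b.first := fun c z => by
    simp [eichler_mulVec, h_zero_right]
  have hc : star ((m : ℂ) * δ) = -((m : ℂ) * δ) := by
    simp [hδ]
  set T := L.eichler b.first_first h0 (m * δ) with hT
  have hentry : ∀ c : ℂ, c = m * δ ∨ c = -(m * δ) → ∀ i j,
      (1 + c • M) i j ∈ quadField D ∧ IsIntegral ℤ ((1 + c • M) i j) := by
    intro c hc' i j
    have h3 : (1 : Matrix (Fin (n + 1)) (Fin (n + 1)) ℂ) i j ∈ quadField D ∧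
        IsIntegral ℤ ((1 : Matrix (Fin (n + 1)) (Fin (n + 1)) ℂ) i j) := by
      rw [Matrix.one_apply]
      split_ifs
      · exact ⟨one_mem _, isIntegral_one⟩
      · exact ⟨zero_mem _, isIntegral_zero⟩
    have h4 : (m : ℂ) * δ * M i j ∈ quadField D ∧ IsIntegral ℤ ((m : ℂ) * δ * M i j) := by
      rw [mul_assoc]
      exact ⟨mul_mem (natCast_mem _ m) (mul_mem hδK (hMK i j)), hmi (i, j)⟩
    rw [Matrix.add_apply, Matrix.smul_apply, smul_eq_mul]
    rcases hc' with rfl | rfl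
    · exact ⟨add_mem h3.1 h4.1, h3.2.add h4.2⟩
    · rw [neg_mul]
      exact ⟨add_mem h3.1 (neg_mem h4.1), h3.2.add h4.2.neg⟩
  have hTval : T.val = 1 + ((m : ℂ) * δ) • M := val_eq_of_transvection (hTz _)
  have hTinv : (T⁻¹).val = 1 + (-((m : ℂ) * δ)) • M := by
    refine val_eq_of_transvection fun z => ?_
    have e1 : (T⁻¹).val = L.eichlerMatrix b.first (-0) (-(m * δ)) := rfl
    rw [e1, eichlerMatrix_mulVec]
    simp [h_zero_right]
  have hTL : T ∈ L.latticeUnitary := by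
    refine mem_latticeUnitary_of_isIntegral (L.eichler_mem_realUnitary _ _ hc) ?_ ?_
    · rw [hTval]; exact hentry _ (Or.inl rfl)
    · rw [hTinv]; exact hentry _ (Or.inr rfl)
  obtain ⟨k, hk, -, hkΓ⟩ := Subgroup.exists_pow_mem_of_relIndex_ne_zero hfin.relIndex_ne_zero hTL
  have hpow : ∀ k : ℕ, ∀ z, (T ^ k).val *ᵥ z =
      z + ((k * (m * δ)) * L.h z b.first) • b.first := by
    intro k
    induction k with
    | zero => simp
    | succ k ih =>
      intro z
      rw [pow_succ, Units.val_mul, ← Matrix.mulVec_mulVec, hTz, ih, h_add_left, h_smul_left,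
        b.first_first, mul_zero, add_zero, add_assoc, ← add_smul]
      push_cast
      ring_nf
  have hTN : T ^ k ∈ L.N (Submodule.span ℂ {b.first}) :=
    pow_mem (L.eichler_mem_N b.first_first h0 hc) k
  have hTU := L.mem_U_of_transvection b.first_first hTN (hpow k)
  rw [b.span_first] at hTU
  have hpos : 0 < Real.sqrt (-(D : ℝ)) := Real.sqrt_pos.2 hd
  refine ⟨k * (m * Real.sqrt (-(D : ℝ))),
    b.mem_translations_of_transvection ⟨hTU, hkΓ.1⟩ fun z => ?_, by positivity⟩
  rw [hpow, hδ]
  push_cast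
  ring_nf

/-- The infimum in `period` is attained because the translations form a nonzero discrete subgroup of
ℝ. -/
lemma isLeast_period (hD : D < 0) (hΓ : Γ ≤ L.latticeUnitary)
    (hfin : Γ.IsFiniteRelIndex L.latticeUnitary) :
    IsLeast {x | x ∈ b.translations Γ ∧ 0 < x} (b.period Γ) := by
  obtain ⟨x, hx, hx0⟩ := b.exists_pos_mem_translations hD hfin
  obtain ⟨δ, hδ, hle⟩ := b.exists_pos_le_abs_of_mem_translations hD hΓ
  obtain ⟨p, hp⟩ := AddSubgroup.exists_isLeast_pos (H := b.translations Γ)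
    (fun h => hx0.ne' (by simpa [h] using hx)) hδ (Set.disjoint_left.2 fun y hy hy' => by
      have := hle y hy hy'.1.ne'
      rw [abs_of_pos hy'.1] at this
      exact absurd hy'.2 (not_lt.2 this))
  have h1 : b.period Γ = p := by
    rw [← hp.csInf_eq, period]
    congr 1
    ext y
    exact and_comm
  rwa [h1]

lemma period_pos (hD : D < 0) (hΓ : Γ ≤ L.latticeUnitary)
    (hfin : Γ.IsFiniteRelIndex L.latticeUnitary) : 0 < b.period Γ :=
  (b.isLeast_period hD hΓ hfin).1.2

lemma exists_int_mul_period (hD : D < 0) (hΓ : Γ ≤ L.latticeUnitary)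
    (hfin : Γ.IsFiniteRelIndex L.latticeUnitary) {x : ℝ} (hx : x ∈ b.translations Γ) :
    ∃ k : ℤ, x = k * b.period Γ := by
  rw [AddSubgroup.cyclic_of_min (b.isLeast_period hD hΓ hfin),
    AddSubgroup.mem_closure_singleton] at hx
  obtain ⟨k, hk⟩ := hx
  exact ⟨k, by simpa using hk.symm⟩

lemma sigma_ne_zero (hD : D < 0) (hΓ : Γ ≤ L.latticeUnitary)
    (hfin : Γ.IsFiniteRelIndex L.latticeUnitary) : b.sigma Γ ≠ 0 :=
  mul_ne_zero (mul_ne_zero Complex.I_ne_zero b.a_ne_zero)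
    (Complex.ofReal_ne_zero.2 (b.period_pos hD hΓ hfin).ne')

end AdaptedBasis

end HermitianLattice

end BallQuotient

/-! ### The action in the coordinates (θ, w). -/

namespace BallQuotient

namespace HermitianLattice

variable {D : ℤ} {n : ℕ} {L : HermitianLattice D n}

lemma mk_mem_hyperbolicSpace {v : Fin (n + 1) → ℂ} (hv : v ≠ 0) :
    Projectivization.mk ℂ v hv ∈ L.hyperbolicSpace ↔ (L.h v v).re < 0 := by
  obtain ⟨c, hc⟩ := Projectivization.exists_smul_eq_mk_rep ℂ v hv
  change (L.h (Projectivization.mk ℂ v hv).rep (Projectivization.mk ℂ v hv).rep).re < 0 ↔ _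
  rw [← hc, Units.smul_def, h_smul_smul_self, Complex.re_ofReal_mul]
  have := Complex.normSq_pos.2 c.ne_zero
  constructor
  · intro h1
    by_contra h2
    exact absurd h1 (not_lt.2 (mul_nonneg this.le (not_lt.1 h2)))
  · intro h1
    exact mul_neg_of_pos_of_neg this h1

lemma mulVec_ne_zero (g : GL (Fin (n + 1)) ℂ) {v : Fin (n + 1) → ℂ} (hv : v ≠ 0) :
    g.val *ᵥ v ≠ 0 := fun h0 => hv (by rw [← inv_mulVec_mulVec g v, h0, Matrix.mulVec_zero])

lemma toLin_smul_eq_mk (g : GL (Fin (n + 1)) ℂ) (x : ℙ ℂ (Fin (n + 1) → ℂ)) :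
    Matrix.GeneralLinearGroup.toLin g • x =
      Projectivization.mk ℂ (g.val *ᵥ x.rep) (mulVec_ne_zero g x.rep_nonzero) := by
  conv_lhs => rw [← x.mk_rep]
  rfl

lemma toLin_smul_mem_hyperbolicSpace {g : GL (Fin (n + 1)) ℂ} (hg : g ∈ L.realUnitary)
    {x : ℙ ℂ (Fin (n + 1) → ℂ)} (hx : x ∈ L.hyperbolicSpace) :
    Matrix.GeneralLinearGroup.toLin g • x ∈ L.hyperbolicSpace := by
  rw [toLin_smul_eq_mk, mk_mem_hyperbolicSpace, L.mem_realUnitary_iff.1 hg]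
  exact hx

namespace AdaptedBasis

variable {E : Submodule ℂ (Fin (n + 1) → ℂ)} (b : L.AdaptedBasis E)

lemma alpha_mk {v : Fin (n + 1) → ℂ} (hv : v ≠ 0) : b.alpha (Projectivization.mk ℂ v hv) =
    b.basis.repr v (.inl ()) / b.basis.repr v (.inr (.inr ())) := by
  obtain ⟨c, hc⟩ := Projectivization.exists_smul_eq_mk_rep ℂ v hv
  rw [alpha, ← hc, Units.smul_def, map_smul, Finsupp.smul_apply, Finsupp.smul_apply,
    smul_eq_mul, smul_eq_mul, mul_div_mul_left _ _ c.ne_zero]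

lemma w_mk {v : Fin (n + 1) → ℂ} (hv : v ≠ 0) (i : Fin (n - 1)) :
    b.w (Projectivization.mk ℂ v hv) i =
      b.basis.repr v (.inr (.inl i)) / b.basis.repr v (.inr (.inr ())) := by
  obtain ⟨c, hc⟩ := Projectivization.exists_smul_eq_mk_rep ℂ v hv
  rw [w, ← hc, Units.smul_def, map_smul, Finsupp.smul_apply, Finsupp.smul_apply,
    smul_eq_mul, smul_eq_mul, mul_div_mul_left _ _ c.ne_zero]

/-- Where t_{n+1} = 0 the vector is orthogonal to b₁, and there h is nonnegative. So α and w never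
involve division by zero on ℂHⁿ. -/
lemma repr_last_ne_zero {v : Fin (n + 1) → ℂ} (hv : (L.h v v).re < 0) :
    b.basis.repr v (.inr (.inr ())) ≠ 0 := fun h0 => by
  have h1 : L.h v b.first = 0 := by rw [b.h_left_first, h0, zero_mul]
  exact absurd hv (not_lt.2
    (L.h_self_nonneg_of_orthogonal (b.basis.ne_zero _) b.first_first h1))

/-- The vector with coordinates `α = 0`, `w` and `tₙ₊₁ = 1`. -/
noncomputable def affineVector (w : Fin (n - 1) → ℂ) : Fin (n + 1) → ℂ :=
  ∑ i, w i • b.mid i + b.last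

lemma repr_affineVector_first (w : Fin (n - 1) → ℂ) :
    b.basis.repr (b.affineVector w) (.inl ()) = 0 := by
  simp [affineVector]

lemma repr_affineVector_mid (w : Fin (n - 1) → ℂ) (i : Fin (n - 1)) :
    b.basis.repr (b.affineVector w) (.inr (.inl i)) = w i := by
  simp [affineVector, Finsupp.single_apply]

lemma repr_affineVector_last (w : Fin (n - 1) → ℂ) :
    b.basis.repr (b.affineVector w) (.inr (.inr ())) = 1 := by
  simp [affineVector]

lemma continuous_affineVector : Continuous b.affineVector := by
  unfold affineVector
  fun_prop

lemma h_affineVector_first (w : Fin (n - 1) → ℂ) : L.h (b.affineVector w) b.first = b.a := by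
  rw [b.h_left_first, repr_affineVector_last, one_mul]

lemma h_first_affineVector (w : Fin (n - 1) → ℂ) : L.h b.first (b.affineVector w) = star b.a := by
  rw [← star_h, h_affineVector_first]

lemma affineVector_zero : b.affineVector 0 = b.last := by
  simp [affineVector]

lemma repr_first_first : b.basis.repr b.first (.inl ()) = 1 := by simp

lemma repr_first_mid (i : Fin (n - 1)) : b.basis.repr b.first (.inr (.inl i)) = 0 := by simp

lemma repr_first_last : b.basis.repr b.first (.inr (.inr ())) = 0 := by simp

lemma ext_repr {x y : Fin (n + 1) → ℂ}
    (h1 : b.basis.repr x (.inl ()) = b.basis.repr y (.inl ()))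
    (h2 : ∀ i, b.basis.repr x (.inr (.inl i)) = b.basis.repr y (.inr (.inl i)))
    (h3 : b.basis.repr x (.inr (.inr ())) = b.basis.repr y (.inr (.inr ()))) : x = y := by
  refine b.basis.repr.injective (Finsupp.ext fun i => ?_)
  rcases i with ⟨⟩ | i | ⟨⟩
  exacts [h1, h2 i, h3]

lemma rep_eq_smul {x : ℙ ℂ (Fin (n + 1) → ℂ)} (hx : x ∈ L.hyperbolicSpace) :
    x.rep = b.basis.repr x.rep (.inr (.inr ())) • (b.alpha x • b.first + b.affineVector (b.w x)) := by
  have h0 := b.repr_last_ne_zero hx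
  apply b.ext_repr
  · simp only [map_smul, map_add, Finsupp.smul_apply, Finsupp.add_apply, smul_eq_mul,
      repr_first_first, repr_affineVector_first, alpha]
    field_simp
    ring
  · intro i
    simp only [map_smul, map_add, Finsupp.smul_apply, Finsupp.add_apply, smul_eq_mul,
      repr_first_mid, repr_affineVector_mid, w]
    field_simp
    ring
  · simp only [map_smul, map_add, Finsupp.smul_apply, Finsupp.add_apply, smul_eq_mul,
      repr_first_last, repr_affineVector_last]
    ring

variable (Γ : Subgroup (GL (Fin (n + 1)) ℂ))

/-- The action of an element `g` of `N(F)` with `g b₁ = ε b₁`, `ε = ±1`, in the coordinates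
`(θ, w)`. -/
noncomputable def coordAction (g : GL (Fin (n + 1)) ℂ) (ε : ℂ) (p : ℂ × (Fin (n - 1) → ℂ)) :
    ℂ × (Fin (n - 1) → ℂ) :=
  (p.1 * Complex.exp (2 * Real.pi * Complex.I *
      (ε * b.basis.repr (g.val *ᵥ b.affineVector p.2) (.inl ())) / b.sigma Γ),
    fun i => ε * b.basis.repr (g.val *ᵥ b.affineVector p.2) (.inr (.inl i)))

lemma continuous_coordAction (g : GL (Fin (n + 1)) ℂ) (ε : ℂ) :
    Continuous (b.coordAction Γ g ε) := by
  have h1 : ∀ i, Continuous fun p : ℂ × (Fin (n - 1) → ℂ) =>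
      b.basis.repr (g.val *ᵥ b.affineVector p.2) i := fun i => by
    have h2 : Continuous (b.basis.coord i) := LinearMap.continuous_of_finiteDimensional _
    have h3 : Continuous fun p : ℂ × (Fin (n - 1) → ℂ) => g.val *ᵥ b.affineVector p.2 :=
      continuous_const.matrix_mulVec (b.continuous_affineVector.comp continuous_snd)
    exact h2.comp h3
  unfold coordAction
  have h4 := h1 (.inl ())
  refine Continuous.prodMk ?_ (continuous_pi fun i => continuous_const.mul (h1 _))
  exact continuous_fst.mul (Complex.continuous_exp.comp
    ((continuous_const.mul (continuous_const.mul h4)).div_const _))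

lemma repr_mulVec_last {g : GL (Fin (n + 1)) ℂ} (hg : g ∈ L.realUnitary) {ε : ℂ}
    (hε : ε = 1 ∨ ε = -1) (hgε : g.val *ᵥ b.first = ε • b.first) (z : Fin (n + 1) → ℂ) :
    b.basis.repr (g.val *ᵥ z) (.inr (.inr ())) = ε * b.basis.repr z (.inr (.inr ())) := by
  have h1 := L.mem_realUnitary_iff.1 hg z b.first
  rw [hgε, h_smul_right, b.h_left_first, b.h_left_first, ← mul_assoc] at h1
  have h2 := mul_right_cancel₀ b.a_ne_zero h1
  rw [← h2]
  rcases hε with rfl | rfl <;> simp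

/-- Both the b₁-term and t_{n+1} pick up the factor ε. It cancels from α, leaving only a shift that
depends on w, which the exponential turns into a factor of θ. -/
lemma toTorus_smul {g : GL (Fin (n + 1)) ℂ} (hg : g ∈ L.realUnitary) {ε : ℂ}
    (hε : ε = 1 ∨ ε = -1) (hgε : g.val *ᵥ b.first = ε • b.first)
    {x : ℙ ℂ (Fin (n + 1) → ℂ)} (hx : x ∈ L.hyperbolicSpace) :
    b.toTorus Γ (Matrix.GeneralLinearGroup.toLin g • x) =
      b.coordAction Γ g ε (b.toTorus Γ x) := by
  have h0 := b.repr_last_ne_zero hx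
  have hε0 : ε ≠ 0 := by rcases hε with rfl | rfl <;> norm_num
  have hεε : ε⁻¹ = ε := by rcases hε with rfl | rfl <;> norm_num
  have hlast := b.repr_mulVec_last hg hε hgε x.rep
  have hrep : g.val *ᵥ x.rep = b.basis.repr x.rep (.inr (.inr ())) •
      ((b.alpha x * ε) • b.first + g.val *ᵥ b.affineVector (b.w x)) := by
    conv_lhs => rw [b.rep_eq_smul hx]
    rw [Matrix.mulVec_smul, Matrix.mulVec_add, Matrix.mulVec_smul, hgε, smul_smul]
  have hα : b.alpha (Matrix.GeneralLinearGroup.toLin g • x) =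
      b.alpha x + ε * b.basis.repr (g.val *ᵥ b.affineVector (b.w x)) (.inl ()) := by
    rw [toLin_smul_eq_mk, alpha_mk, hlast, hrep]
    simp only [map_smul, map_add, Finsupp.smul_apply, Finsupp.add_apply, smul_eq_mul,
      repr_first_first]
    rw [mul_comm ε, mul_div_mul_left _ _ h0, add_div, mul_one, mul_div_cancel_right₀ _ hε0,
      div_eq_inv_mul _ ε, hεε]
  have hw : ∀ i, b.w (Matrix.GeneralLinearGroup.toLin g • x) i =
      ε * b.basis.repr (g.val *ᵥ b.affineVector (b.w x)) (.inr (.inl i)) := fun i => by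
    rw [toLin_smul_eq_mk, w_mk, hlast, hrep]
    simp only [map_smul, map_add, Finsupp.smul_apply, Finsupp.add_apply, smul_eq_mul,
      repr_first_mid]
    rw [mul_comm ε, mul_div_mul_left _ _ h0, mul_zero, zero_add, div_eq_inv_mul _ ε, hεε]
  refine Prod.ext ?_ (funext hw)
  change Complex.exp _ = Complex.exp _ * Complex.exp _
  rw [hα, ← Complex.exp_add, mul_add, add_div]
  rfl

variable {Γ}

/-- The element shifts α by an integer multiple of σ, which the exponential does not see. -/
lemma toTorus_smul_of_mem_UZ (hD : D < 0) (hΓ : Γ ≤ L.latticeUnitary)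
    (hfin : Γ.IsFiniteRelIndex L.latticeUnitary) {g : GL (Fin (n + 1)) ℂ} (hg : g ∈ L.UZ Γ E)
    {x : ℙ ℂ (Fin (n + 1) → ℂ)} (hx : x ∈ L.hyperbolicSpace) :
    b.toTorus Γ (Matrix.GeneralLinearGroup.toLin g • x) = b.toTorus Γ x := by
  obtain ⟨y, hy⟩ := b.exists_transvection_of_mem_U hg.1
  obtain ⟨k, hk⟩ := b.exists_int_mul_period hD hΓ hfin (b.mem_translations_of_transvection hg hy)
  have h1 : g.val *ᵥ b.first = (1 : ℂ) • b.first := by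
    rw [one_smul, b.mulVec_first_of_mem_U hg.1]
  rw [b.toTorus_smul Γ (mem_realUnitary_of_mem_U hg.1) (Or.inl rfl) h1 hx]
  have hσ := b.sigma_ne_zero hD hΓ hfin
  refine Prod.ext ?_ (funext fun i => ?_)
  · simp only [coordAction, hy, h_affineVector_first, map_add, map_smul, Finsupp.add_apply,
      Finsupp.smul_apply, repr_affineVector_first, repr_first_first, smul_eq_mul]
    have h2 : 2 * Real.pi * Complex.I * (1 * (0 + Complex.I * y * b.a * 1)) / b.sigma Γ =
        k * (2 * Real.pi * Complex.I) := by
      rw [div_eq_iff hσ, hk, sigma]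
      push_cast
      ring
    rw [h2, Complex.exp_int_mul_two_pi_mul_I, mul_one]
  · simp only [coordAction, hy, map_add, map_smul, Finsupp.add_apply,
      Finsupp.smul_apply, repr_affineVector_mid, repr_first_mid, smul_eq_mul]
    ring

/-- Every boundary point is a limit of points of `ℂHⁿ(F)`. -/
lemma boundary_mem_closure (hD : D < 0) (hΓ : Γ ≤ L.latticeUnitary)
    (hfin : Γ.IsFiniteRelIndex L.latticeUnitary) (w : Fin (n - 1) → ℂ) :
    ((0, w) : ℂ × (Fin (n - 1) → ℂ)) ∈ closure (b.toTorus Γ '' L.hyperbolicSpace) := by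
  have hσ := b.sigma_ne_zero hD hΓ hfin
  have hp := b.period_pos hD hΓ hfin
  have hna := Complex.normSq_pos.2 b.a_ne_zero
  -- Taking α = iσy gives θ = exp(-2πy) → 0, while h(v,v) decreases linearly in y and is eventually
  -- negative.
  set v : ℝ → Fin (n + 1) → ℂ := fun y => (b.sigma Γ * (Complex.I * y)) • b.first + b.affineVector w
    with hv
  have hlast : ∀ y, b.basis.repr (v y) (.inr (.inr ())) = 1 := fun y => by
    simp only [hv, map_add, map_smul, Finsupp.add_apply, Finsupp.smul_apply, repr_first_last,
      repr_affineVector_last, smul_eq_mul]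
    ring
  have hfirst : ∀ y, b.basis.repr (v y) (.inl ()) = b.sigma Γ * (Complex.I * y) := fun y => by
    simp only [hv, map_add, map_smul, Finsupp.add_apply, Finsupp.smul_apply, repr_first_first,
      repr_affineVector_first, smul_eq_mul]
    ring
  have hmid : ∀ y i, b.basis.repr (v y) (.inr (.inl i)) = w i := fun y i => by
    simp only [hv, map_add, map_smul, Finsupp.add_apply, Finsupp.smul_apply, repr_first_mid,
      repr_affineVector_mid, smul_eq_mul]
    ring
  have hv0 : ∀ y, v y ≠ 0 := fun y h0 => by simpa [h0] using hlast y
  have hT : ∀ y : ℝ, b.toTorus Γ (Projectivization.mk ℂ (v y) (hv0 y)) =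
      (((Real.exp (-(2 * Real.pi * y)) : ℝ) : ℂ), w) := fun y => by
    refine Prod.ext ?_ (funext fun i => ?_)
    · change Complex.exp _ = _
      rw [alpha_mk, hlast, hfirst, Complex.ofReal_exp]
      congr 1
      rw [div_one]
      field_simp
      push_cast
      linear_combination (2 * Real.pi * y : ℂ) * Complex.I_sq
    · change b.w _ i = _
      rw [w_mk, hlast, hmid, div_one]
  have hh : ∀ y : ℝ, (L.h (v y) (v y)).re =
      (L.h (b.affineVector w) (b.affineVector w)).re - 2 * (b.period Γ * Complex.normSq b.a) * y := by
    intro y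
    have h1 : L.h (v y) (v y) = L.h (b.affineVector w) (b.affineVector w) -
        ((2 * (b.period Γ * Complex.normSq b.a) * y : ℝ) : ℂ) := by
      simp only [hv, h_add_left, h_add_right, h_smul_left, h_smul_right, b.first_first,
        h_affineVector_first, h_first_affineVector, sigma, star_mul', Complex.star_def, Complex.conj_I,
        Complex.conj_ofReal]
      push_cast
      rw [← Complex.mul_conj]
      linear_combination
        (2 * b.a * (starRingEnd ℂ) b.a * b.period Γ * y : ℂ) * Complex.I_sq
    rw [h1, Complex.sub_re, Complex.ofReal_re]
  refine mem_closure_of_tendsto (f := fun y : ℝ =>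
    ((((Real.exp (-(2 * Real.pi * y)) : ℝ) : ℂ), w) : ℂ × (Fin (n - 1) → ℂ)))
    (b := Filter.atTop) ?_ ?_
  · refine Filter.Tendsto.prodMk_nhds ?_ tendsto_const_nhds
    rw [← Complex.ofReal_zero]
    refine (Complex.continuous_ofReal.tendsto 0).comp (Real.tendsto_exp_neg_atTop_nhds_zero.comp ?_)
    exact Filter.tendsto_id.const_mul_atTop (by positivity)
  · have hc : 0 < 2 * (b.period Γ * Complex.normSq b.a) := by positivity
    filter_upwards [(Filter.tendsto_id.const_mul_atTop hc).eventually_gt_atTop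
      (L.h (b.affineVector w) (b.affineVector w)).re] with y hy
    refine ⟨_, ?_, hT y⟩
    rw [mk_mem_hyperbolicSpace, hh]
    simp only [id] at hy
    linarith

/-- An element of `N(F)_ℤ` that fixes `b₁` and the coordinate `w` lies in `U(F)_ℤ`. -/
lemma mem_UZ_of_repr_mid_eq {g : GL (Fin (n + 1)) ℂ} (hg : g ∈ L.NZ Γ E)
    (hg1 : g.val *ᵥ b.first = b.first)
    (hmid : ∀ w i, b.basis.repr (g.val *ᵥ b.affineVector w) (.inr (.inl i)) = w i) :
    g ∈ L.UZ Γ E := by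
  refine ⟨?_, hg.2⟩
  have hgN := hg.1
  have hgu := L.mem_realUnitary_iff.1 hgN.1
  have hstar : star b.a ≠ 0 := star_ne_zero.2 b.a_ne_zero
  set r : (Fin (n - 1) → ℂ) → ℂ := fun w => b.basis.repr (g.val *ᵥ b.affineVector w) (.inl ()) with hr
  have h1 : ∀ w, g.val *ᵥ b.affineVector w = b.affineVector w + r w • b.first := fun w => by
    apply b.ext_repr
    · simp [repr_affineVector_first, hr]
    · intro i
      rw [hmid]
      simp [repr_affineVector_mid]
    · rw [b.repr_mulVec_last hgN.1 (Or.inl rfl) (by rw [hg1, one_smul])]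
      simp
  -- Invariance of h on the pair of points w and 0 makes the shift of α independent of w.
  have h2 : ∀ w, star (r 0) * b.a + r w * star b.a = 0 := fun w => by
    have h3 := hgu (b.affineVector w) (b.affineVector 0)
    rw [h1, h1] at h3
    simp only [h_add_left, h_add_right, h_smul_left, h_smul_right, b.first_first,
        h_affineVector_first, h_first_affineVector] at h3
    linear_combination h3
  have h3 : ∀ w, r w = r 0 := fun w =>
    mul_right_cancel₀ hstar (by linear_combination h2 w - h2 0)
  have h4 : ∀ z, g.val *ᵥ z = z + (r 0 / b.a * L.h z b.first) • b.first := by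
    have h5 : Matrix.mulVecLin g.val = Matrix.mulVecLin
        (1 + (r 0 / b.a) • Matrix.vecMulVec b.first (star b.first ᵥ* L.Q)) := by
      have h6 : ∀ z, (1 + (r 0 / b.a) • Matrix.vecMulVec b.first (star b.first ᵥ* L.Q)) *ᵥ z =
          z + (r 0 / b.a * L.h z b.first) • b.first := fun z => by
        rw [Matrix.add_mulVec, Matrix.one_mulVec, Matrix.smul_mulVec, vecMulVec_mulVec_eq_h_smul,
          smul_smul]
      have h7 : ∀ w, g.val *ᵥ b.affineVector w =
          (1 + (r 0 / b.a) • Matrix.vecMulVec b.first (star b.first ᵥ* L.Q)) *ᵥ b.affineVector w :=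
        fun w => by
          rw [h1, h6, h_affineVector_first, div_mul_cancel₀ _ b.a_ne_zero, h3]
      refine b.basis.ext fun i => ?_
      rw [Matrix.mulVecLin_apply, Matrix.mulVecLin_apply]
      rcases i with ⟨⟩ | i | ⟨⟩
      · rw [hg1, h6, b.first_first, mul_zero, zero_smul, add_zero]
      -- The affine vectors together with b₁ span, so agreement on them determines g.
      · have h8 : b.mid i = b.affineVector (Pi.single i 1) - b.affineVector 0 := by
          simp [affineVector, Pi.single_apply, ite_smul]
        change g.val *ᵥ b.mid i = _ *ᵥ b.mid i
        rw [h8, Matrix.mulVec_sub, Matrix.mulVec_sub, h7, h7]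
      · have h8 := h7 0
        rwa [affineVector_zero] at h8
    intro z
    have h6 := congrArg (fun k : (Fin (n + 1) → ℂ) →ₗ[ℂ] (Fin (n + 1) → ℂ) => k z) h5
    simp only [Matrix.mulVecLin_apply] at h6
    rw [h6, Matrix.add_mulVec, Matrix.one_mulVec, Matrix.smul_mulVec, vecMulVec_mulVec_eq_h_smul,
      smul_smul]
  rw [← b.span_first] at hgN ⊢
  exact L.mem_U_of_transvection b.first_first hgN h4

end AdaptedBasis

end HermitianLattice

end BallQuotient

/-! ### Existence and uniqueness of the extension, and the main theorem. -/

namespace BallQuotient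

namespace HermitianLattice

namespace AdaptedBasis

variable {D : ℤ} {n : ℕ} {L : HermitianLattice D n} {E : Submodule ℂ (Fin (n + 1) → ℂ)}
  (b : L.AdaptedBasis E) {Γ : Subgroup (GL (Fin (n + 1)) ℂ)}

lemma dense_interior (hD : D < 0) (hΓ : Γ ≤ L.latticeUnitary)
    (hfin : Γ.IsFiniteRelIndex L.latticeUnitary) :
    Dense {p : b.partialCompactification Γ | p.val ∈ b.toTorus Γ '' L.hyperbolicSpace} := by
  rintro ⟨⟨θ, w⟩, hp⟩
  rw [closure_subtype]
  have himg : ((↑) : b.partialCompactification Γ → ℂ × (Fin (n - 1) → ℂ)) ''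
      {p | p.val ∈ b.toTorus Γ '' L.hyperbolicSpace} = b.toTorus Γ '' L.hyperbolicSpace := by
    ext q
    constructor
    · rintro ⟨p, hp, rfl⟩
      exact hp
    · intro hq
      exact ⟨⟨q, Or.inl hq⟩, hq, rfl⟩
  rw [himg]
  rcases hp with hp | hp
  · exact subset_closure hp
  · obtain rfl : θ = 0 := hp
    exact b.boundary_mem_closure hD hΓ hfin w

lemma isExtendedAction_unique (hD : D < 0) (hΓ : Γ ≤ L.latticeUnitary)
    (hfin : Γ.IsFiniteRelIndex L.latticeUnitary) {γ : L.CuspGroup Γ E}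
    {φ ψ : b.partialCompactification Γ → b.partialCompactification Γ}
    (hφ : b.IsExtendedAction Γ γ φ) (hψ : b.IsExtendedAction Γ γ ψ) : φ = ψ := by
  obtain ⟨g, rfl⟩ := QuotientGroup.mk_surjective γ
  refine Continuous.ext_on (b.dense_interior hD hΓ hfin) hφ.1 hψ.1 ?_
  rintro ⟨_, hp⟩ ⟨x, hx, rfl⟩
  exact Subtype.ext ((hφ.2 g rfl x hx).trans (hψ.2 g rfl x hx).symm)

lemma mulVec_first_of_mem_NZ (hD : D < -3) (hsq : Squarefree D) (hΓ : Γ ≤ L.latticeUnitary)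
    {g : GL (Fin (n + 1)) ℂ} (hg : g ∈ L.NZ Γ E) :
    ∃ ε : ℂ, (ε = 1 ∨ ε = -1) ∧ g.val *ᵥ b.first = ε • b.first := by
  obtain ⟨hgN, hgΓ⟩ := hg
  rw [← b.span_first] at hgN
  exact mulVec_eq_or_eq_neg hD hsq (hΓ hgΓ) (b.basis.ne_zero _) (b.rational _) hgN

/-- The self-map of the partial compactification given by an element of `N(F)_ℤ`. -/
noncomputable def extendedAction {g : GL (Fin (n + 1)) ℂ} (hg : g ∈ L.realUnitary) {ε : ℂ}
    (hε : ε = 1 ∨ ε = -1) (hgε : g.val *ᵥ b.first = ε • b.first)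
    (p : b.partialCompactification Γ) : b.partialCompactification Γ :=
  ⟨b.coordAction Γ g ε p.val, by
    obtain ⟨p, ⟨x, hx, rfl⟩ | hp⟩ := p
    · exact Or.inl ⟨_, toLin_smul_mem_hyperbolicSpace hg hx, b.toTorus_smul Γ hg hε hgε hx⟩
    · refine Or.inr ?_
      change p.1 * _ = 0
      rw [show p.1 = 0 from hp, zero_mul]⟩

/-- Another representative of the class is g·u with u in U(F)_ℤ, and u does not change (θ, w). -/
lemma isExtendedAction_extendedAction (hD : D < 0) (hΓ : Γ ≤ L.latticeUnitary)
    (hfin : Γ.IsFiniteRelIndex L.latticeUnitary) (g : L.NZ Γ E) {ε : ℂ}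
    (hε : ε = 1 ∨ ε = -1) (hgε : g.val.val *ᵥ b.first = ε • b.first) :
    b.IsExtendedAction Γ (QuotientGroup.mk g) (b.extendedAction g.2.1.1 hε hgε) := by
  refine ⟨((b.continuous_coordAction Γ g.val ε).comp continuous_subtype_val).subtype_mk _,
    fun g' hg' x hx => ?_⟩
  have hu : g.val⁻¹ * g'.val ∈ L.UZ Γ E := 
    (QuotientGroup.eq (s := (L.UZ Γ E).subgroupOf (L.NZ Γ E))).1 hg'.symm
  have hx' := toLin_smul_mem_hyperbolicSpace (mem_realUnitary_of_mem_U hu.1) hx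
  have e1 : g'.val = g.val * (g.val⁻¹ * g'.val) := by group
  rw [e1, map_mul, mul_smul, b.toTorus_smul Γ g.2.1.1 hε hgε hx',
    b.toTorus_smul_of_mem_UZ hD hΓ hfin hu hx]
  rfl

end AdaptedBasis

end HermitianLattice

end BallQuotient

theorem mainTheorem8 (D : ℤ) (hD : D < -3) (hsq : Squarefree D) (n : ℕ)
    (L : BallQuotient.HermitianLattice D n)
    (Γ : Subgroup (Matrix.GeneralLinearGroup (Fin (n + 1)) ℂ))
    (hΓ : Γ ≤ L.latticeUnitary) (hfin : Γ.IsFiniteRelIndex L.latticeUnitary)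
    (hneg : -1 ∈ Γ)
    (E : Submodule ℂ (Fin (n + 1) → ℂ)) (hE : L.IsCusp E) (b : L.AdaptedBasis E) :
    (∀ γ : L.CuspGroup Γ E,
      ∃! φ : b.partialCompactification Γ → b.partialCompactification Γ,
        b.IsExtendedAction Γ γ φ) ∧
    ∀ γ : L.CuspGroup Γ E, γ ≠ 1 → γ ≠ QuotientGroup.mk ⟨-1, L.neg_one_mem_NZ hneg E⟩ →
      ∀ φ : b.partialCompactification Γ → b.partialCompactification Γ,
        b.IsExtendedAction Γ γ φ →
          ¬ ∀ p : b.partialCompactification Γ,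
            p.val ∈ BallQuotient.HermitianLattice.AdaptedBasis.boundaryDivisor n → φ p = p := by
  have hD0 : D < 0 := by omega
  refine ⟨fun γ => ?_, fun γ hγ1 hγ2 φ hφ hfix => ?_⟩
  · obtain ⟨g, rfl⟩ := QuotientGroup.mk_surjective γ
    obtain ⟨ε, hε, hgε⟩ := b.mulVec_first_of_mem_NZ hD hsq hΓ g.2
    have hψ := b.isExtendedAction_extendedAction hD0 hΓ hfin g hε hgε
    exact ⟨_, hψ, fun φ hφ => b.isExtendedAction_unique hD0 hΓ hfin hφ hψ⟩
  · obtain ⟨g, rfl⟩ := QuotientGroup.mk_surjective γ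
    obtain ⟨ε, hε, hgε⟩ := b.mulVec_first_of_mem_NZ hD hsq hΓ g.2
    have hψ := b.isExtendedAction_extendedAction hD0 hΓ hfin g hε hgε
    rw [b.isExtendedAction_unique hD0 hΓ hfin hφ hψ] at hfix
    -- This is the w-component of the fixed-point equation at (0, w).
    have hmid : ∀ w i, ε * b.basis.repr (g.val.val *ᵥ b.affineVector w) (.inr (.inl i)) = w i :=
      fun w i => congrFun (congrArg (fun p => (Subtype.val p).2)
        (hfix ⟨(0, w), Or.inr rfl⟩ rfl)) i
    rcases hε with rfl | rfl
    · have h1 : g.val ∈ L.UZ Γ E := by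
        refine b.mem_UZ_of_repr_mid_eq g.2 ?_ fun w i => ?_
        · rw [hgε, one_smul]
        · rw [← hmid w i, one_mul]
      exact hγ1 ((QuotientGroup.eq_one_iff g).2 h1)
    -- For ε = -1 the argument applies to -g, which fixes b₁ and w. So -g lies in U(F)_ℤ and g is in
    -- the class of -1.
    · refine hγ2 (QuotientGroup.eq.2 ?_)
      have hneg' : -g.val ∈ L.NZ Γ E := by
        simpa using mul_mem (L.neg_one_mem_NZ hneg E) g.2
      have h1 : -g.val ∈ L.UZ Γ E := by
        refine b.mem_UZ_of_repr_mid_eq hneg' ?_ fun w i => ?_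
        · rw [Units.val_neg, Matrix.neg_mulVec, hgε, neg_one_smul, neg_neg]
        · rw [Units.val_neg, Matrix.neg_mulVec, ← hmid w i, map_neg, Finsupp.neg_apply,
            neg_one_mul]
      have h2 : g.val⁻¹ * -1 ∈ L.UZ Γ E := by
        have h3 : g.val⁻¹ * -1 = (-g.val)⁻¹ :=
          (inv_eq_of_mul_eq_one_right (by simp)).symm
        rw [h3]
        exact inv_mem h1
      exact h2
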